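/- Let $X_1,X_2,\dots$ be i.i.d. real random variables and let $J_1,J_2,\dots$ be i.i.d. positive random variables with probability density $f_J$, the two sequences being independent. Put $T_n=\sum_{i=1}^nJ_i$, $N(t)=\max\{n\ge 0:T_n\le t\}$ and $S(t)=S_{N(t)}$, where $S_n=G_n(X_1,\dots,X_n)$ with measurable $G_n:\mathbb R^n\to\mathbb R$ ($n\ge0$). Write $F_Y(u)=\mathbb P(Y\le u)$, and $\mathcal L$ for the Laplace transform. Let $\mathcal L_\oplus$ be a linear transform of distribution functions: for each $w$ there is a measurable weight $\rho_w:\mathbb R\to[0,\infty]$ such that $F\mapsto \mathcal L_\oplus(F)(w)\in\mathbb C$ is additive and positively homogeneous on the distribution functions $F$ of finite measures on $\mathbb R$ with $\int\rho_w\,dF<\infty$, and $|\mathcal L_\oplus(F)(w)|\le\int\rho_w\,dF$ (for example $\mathcal L_\oplus(F)(w)=\int\kappa(w,u)\,dF(u)$ with $\rho_w=|\kappa(w,\cdot)|$). Fix $w$ and suppose that the statistics are of convolution type at $w$, that is, $\mathcal L_\oplus(F_{S_n})(w)=[\mathcal L_\oplus(F_{X_1})(w)]^n$ for all $n\ge0$,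 and that $\mathbb E\,\rho_w(S(t))<\infty$ for all $t\ge0$. Write $a=\mathcal L_\oplus(F_{X_1})(w)$ and $Q(w,t)=\mathcal L_\oplus(F_{S(t)})(w)$. Let the memory kernel $\Phi$ be a Laplace-transformable distribution supported in $[0,\infty)$ (for instance a locally integrable function of at most exponential growth, or the Dirac distribution at $0$) such that, for all sufficiently large real $s$, $$\mathcal L(\Phi)(s)=\frac{1-\mathcal L(f_J)(s)}{s\,\mathcal L(f_J)(s)} .$$ Then $Q(w,\cdot)$ is locally absolutely continuous on $[0,\infty)$ and solves the Cauchy problem $$\int_0^t\Phi(t-t')\,\partial_{t'}Q(w,t')\,dt'=-(1-a)\,Q(w,t),\qquad Q(w,0)=1,$$ where the equation holds in the sense of distributions on $\mathbb R$ supported in $[0,\infty)$: for every $\theta\in C_c^\infty(\mathbb R)$, $$\Big\langle\Phi_x,\ \int_0^\infty\partial_yQ(w,y)\,\theta(x+y)\,dy\Big\rangle=-(1-a)\int_0^\infty Q(w,t)\,\theta(t)\,dt .$$ It is the only solution on $[0,\infty)$ in this sense among the functions that are locally absolutely continuous on $[0,\infty)$. If moreover $\Phi$ is given by a function $\varphi$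 on $(0,\infty)$ with $\int_0^\infty e^{-\sigma t}|\varphi(t)|\,dt<\infty$ for some real $\sigma$, then for almost every $t>0$ the function $t'\mapsto\varphi(t-t')\,\partial_{t'}Q(w,t')$ is integrable on $(0,t)$ and $$\int_0^t\varphi(t-t')\,\partial_{t'}Q(w,t')\,dt'=-(1-a)\,Q(w,t).$$ -/

import Mathlib

open MeasureTheory ProbabilityTheory Set Filter Topology
open scoped ENNReal

namespace CTStat

/-- The distribution function `u ↦ μ (-∞, u]` of a finite measure on the line. -/
noncomputable def distFun (μ : Measure ℝ) : ℝ → ℝ := fun u => μ.real (Iic u)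

/-- The cumulative distribution function `F_Y(u) = P(Y ≤ u)` of a random variable. -/
noncomputable def rvCdf {Ω : Type*} [MeasurableSpace Ω] (P : Measure Ω) (Y : Ω → ℝ) : ℝ → ℝ :=
  fun u => P.real {ω | Y ω ≤ u}

/-- `L` is a linear transform of distribution functions, dominated by the weights `ρ w`: for each
`w`, the map `F ↦ L F w` is additive and positively homogeneous on the distribution functions of
the finite measures `μ` with `∫ ρ w dμ < ∞`, and `|L F w| ≤ ∫ ρ w dF` there. An integral
transform `L F w = ∫ κ w u dF(u)` is of this kind, with `ρ w u = |κ w u|`. -/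
structure IsTransform {W : Type*} (L : (ℝ → ℝ) → W → ℂ) (ρ : W → ℝ → ℝ≥0∞) : Prop where
  measurable : ∀ w, Measurable (ρ w)
  map_add : ∀ (w : W) (μ ν : Measure ℝ), IsFiniteMeasure μ → IsFiniteMeasure ν →
    ∫⁻ u, ρ w u ∂μ < ∞ → ∫⁻ u, ρ w u ∂ν < ∞ →
      L (distFun μ + distFun ν) w = L (distFun μ) w + L (distFun ν) w
  map_smul : ∀ (w : W) (c : ℝ) (μ : Measure ℝ), 0 ≤ c → IsFiniteMeasure μ →
    ∫⁻ u, ρ w u ∂μ < ∞ → L (c • distFun μ) w = (c : ℂ) * L (distFun μ) w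
  bound : ∀ (w : W) (μ : Measure ℝ), IsFiniteMeasure μ →
    ‖L (distFun μ) w‖ₑ ≤ ∫⁻ u, ρ w u ∂μ

section Renewal

variable {Ω : Type*}

/-- The epochs `T_n = J_1 + ⋯ + J_n` (the durations are indexed from `0` here). -/
noncomputable def epoch (J : ℕ → Ω → ℝ) (n : ℕ) (ω : Ω) : ℝ := ∑ i ∈ Finset.range n, J i ω

/-- The counting process `N(t) = max {n : T_n ≤ t}`. For `t ≥ 0` and i.i.d. positive durations the
set is almost surely nonempty and finite. -/
noncomputable def count (J : ℕ → Ω → ℝ) (t : ℝ) (ω : Ω) : ℕ := sSup {n : ℕ | epoch J n ω ≤ t}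

/-- The statistic `S_n = G_n(X_1, …, X_n)`. -/
def stat (G : (n : ℕ) → (Fin n → ℝ) → ℝ) (X : ℕ → Ω → ℝ) (n : ℕ) (ω : Ω) : ℝ :=
  G n (fun i => X i ω)

/-- The continuous-time statistic `S(t) = S_{N(t)}`. -/
noncomputable def ctStat (G : (n : ℕ) → (Fin n → ℝ) → ℝ) (X J : ℕ → Ω → ℝ) (t : ℝ) (ω : Ω) : ℝ :=
  stat G X (count J t ω) ω

end Renewal

/-- The Laplace transform `∫_0^∞ e^{-st} f(t) dt` of a real function, at a real argument. -/
noncomputable def laplaceFun (f : ℝ → ℝ) (s : ℝ) : ℝ := ∫ t in Ioi (0 : ℝ), Real.exp (-s * t) * f t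

/-- Smooth functions on the line all of whose derivatives are `O(e^{-σt})` on `[0,∞)`. -/
def IsDecayTest (σ : ℝ) (θ : ℝ → ℂ) : Prop :=
  ContDiff ℝ (⊤ : ℕ∞) θ ∧ ∀ j : ℕ, ∃ B : ℝ, ∀ t : ℝ, 0 ≤ t →
    Real.exp (σ * t) * ‖iteratedDeriv j θ t‖ ≤ B

/-- A Laplace-transformable distribution carried by `[0,∞)`, as a linear functional on the smooth
functions whose derivatives are `O(e^{-σt})` on `[0,∞)`, bounded by finitely many of the
corresponding norms. The values of `toFun` off this space play no role. Locally integrable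
functions of at most exponential growth, the Dirac distribution at `0` and its derivatives are of
this kind. -/
structure CausalDistribution where
  σ : ℝ
  toFun : (ℝ → ℂ) → ℂ
  map_add : ∀ θ₁ θ₂, IsDecayTest σ θ₁ → IsDecayTest σ θ₂ →
    toFun (θ₁ + θ₂) = toFun θ₁ + toFun θ₂
  map_smul : ∀ (c : ℂ) (θ), IsDecayTest σ θ → toFun (c • θ) = c * toFun θ
  bound : ∃ (m : ℕ) (C : ℝ), ∀ θ, IsDecayTest σ θ → ∀ B : ℝ,
    (∀ j ≤ m, ∀ t : ℝ, 0 ≤ t → Real.exp (σ * t) * ‖iteratedDeriv j θ t‖ ≤ B) →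
      ‖toFun θ‖ ≤ C * B

/-- The Laplace transform `⟨Φ, e^{-st}⟩`; meaningful for `σ ≤ Re s`. -/
noncomputable def CausalDistribution.laplace (Φ : CausalDistribution) (s : ℂ) : ℂ :=
  Φ.toFun (fun t : ℝ => Complex.exp (-s * t))

/-- The pairing `⟨Φ * g, θ⟩ = ⟨Φ_x, ∫_0^∞ g(y) θ(x + y) dy⟩` of the convolution
`(Φ * g)(t) = ∫_0^t Φ(t - t') g(t') dt'` with a test function. -/
noncomputable def CausalDistribution.convPair (Φ : CausalDistribution) (g θ : ℝ → ℂ) : ℂ :=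
  Φ.toFun (fun x : ℝ => ∫ y in Ioi (0 : ℝ), g y * θ (x + y))

/-- `Φ` is given by the function `φ` on `(0,∞)`. -/
def CausalDistribution.IsGivenBy (Φ : CausalDistribution) (φ : ℝ → ℂ) : Prop :=
  IntegrableOn (fun t => (Real.exp (-Φ.σ * t) : ℂ) * φ t) (Ioi 0) ∧
    ∀ θ, IsDecayTest Φ.σ θ → Φ.toFun θ = ∫ t in Ioi (0 : ℝ), φ t * θ t

/-- `q` solves the Cauchy problem
`∫_0^t Φ(t - t') q'(t') dt' = -(1 - a) q(t)`, `q(0) = 1`, on `[0,∞)`: it is locally absolutely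
continuous there, so that `q'` is a locally integrable function, and the equation holds as an
equation between distributions on the line carried by `[0,∞)`. -/
structure SolvesRelaxation (Φ : CausalDistribution) (a : ℂ) (q : ℝ → ℂ) : Prop where
  initial : q 0 = 1
  absCont : ∀ T : ℝ, 0 ≤ T → AbsolutelyContinuousOnInterval q 0 T
  equation : ∀ θ : ℝ → ℂ, ContDiff ℝ (⊤ : ℕ∞) θ → HasCompactSupport θ →
    Φ.convPair (deriv q) θ = -(1 - a) * ∫ t in Ioi (0 : ℝ), q t * θ t

/-- The exponentials `e^{-st}` belong to the test space. -/
theorem isDecayTest_exp (σ : ℝ) (s : ℂ) (h : σ ≤ s.re) : IsDecayTest σ (fun t : ℝ => Complex.exp (-s * t)) := by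
  have key : ∀ j : ℕ, iteratedDeriv j (fun t : ℝ => Complex.exp (-s * t)) = fun t : ℝ => (-s)^j * Complex.exp (-s * t) := by
    intro j
    induction j with
    | zero => simp
    | succ k ih =>
      rw [iteratedDeriv_succ, ih]
      funext t
      have h1 : HasDerivAt (fun t : ℝ => Complex.exp (-s * t)) (Complex.exp (-s * t) * (-s * 1)) t := by
        exact ((Complex.ofRealCLM.hasDerivAt (x := t)).const_mul (-s)).cexp
      rw [(h1.const_mul _).deriv]; ring
  refine ⟨?_, fun j => ⟨‖s‖^j, fun t ht => ?_⟩⟩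
  · have : ContDiff ℝ (⊤ : ℕ∞) (fun t : ℝ => (t : ℂ)) := Complex.ofRealCLM.contDiff
    exact (contDiff_const.mul this).cexp
  · rw [key]
    simp only [norm_mul, norm_pow, norm_neg, Complex.norm_exp]
    have : (-s * (t:ℂ)).re = - s.re * t := by simp
    rw [this, mul_left_comm, ← Real.exp_add]
    have : Real.exp (σ * t + -s.re * t) ≤ 1 := Real.exp_le_one_iff.2 (by nlinarith)
    exact mul_le_of_le_one_right (by positivity) this

/-- The function paired with `Φ` in `convPair` belongs to the test space. -/
theorem isDecayTest_conv (g θ : ℝ → ℂ) (hg : LocallyIntegrable ((Ioi 0).indicator g) volume)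
   (hθ : ContDiff ℝ (⊤ : ℕ∞) θ) (hc : HasCompactSupport θ) (σ : ℝ) :
   IsDecayTest σ (fun x : ℝ => ∫ y in Ioi (0 : ℝ), g y * θ (x + y)) := by
  have hs : ContDiff ℝ (⊤ : ℕ∞) (fun x : ℝ => ∫ y in Ioi (0 : ℝ), g y * θ (x + y)) := by
    have h1 : HasCompactSupport (fun x => θ (-x)) := hc.comp_homeomorph (Homeomorph.neg ℝ)
    have h2 := h1.contDiff_convolution_right (ContinuousLinearMap.mul ℝ ℂ) hg
      (hθ.comp contDiff_neg : ContDiff ℝ (⊤ : ℕ∞) (fun x => θ (-x)))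
    convert h2.comp contDiff_neg using 1
    funext x
    simp only [convolution, Function.comp, ContinuousLinearMap.mul_apply']
    rw [← integral_indicator measurableSet_Ioi]
    congr 1; funext y
    by_cases hy : y ∈ Ioi (0:ℝ) <;> simp [hy, sub_eq_add_neg, add_comm]
  refine ⟨hs, fun j => ?_⟩
  obtain ⟨R, hR⟩ := hc.isCompact.isBounded.subset_closedBall 0
  set H := (fun x : ℝ => ∫ y in Ioi (0 : ℝ), g y * θ (x + y)) with hH
  have hz : ∀ x, R < x → H x = 0 := by
    intro x hx
    rw [hH]
    refine setIntegral_eq_zero_of_forall_eq_zero fun y hy => ?_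
    have : θ (x+y) = 0 := by
      by_contra hne
      have := hR (subset_tsupport _ hne)
      simp [abs_le] at this hy
      linarith
    simp [this]
  have hz' : ∀ x, R < x → iteratedDeriv j H x = 0 := by
    intro x hx
    have : H =ᶠ[𝓝 x] fun _ => 0 := by
      filter_upwards [Ioi_mem_nhds hx] with y hy using hz y hy
    rw [this.iteratedDeriv_eq]; simp
  have hcont : ContinuousOn (fun t => Real.exp (σ*t) * ‖iteratedDeriv j H t‖) (Icc 0 R) := by
    have := hs.continuous_iteratedDeriv j (by exact_mod_cast le_top)
    fun_prop
  obtain ⟨B, hB⟩ := isCompact_Icc.bddAbove_image hcont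
  refine ⟨max B 0, fun t ht => ?_⟩
  by_cases h : t ≤ R
  · exact le_max_of_le_left (hB ⟨t, ⟨ht, h⟩, rfl⟩)
  · rw [hz' t (not_le.1 h)]; simp

end CTStat

namespace CTStat

/-! Write `F_n(t) = P(T_n ≤ t)`, `m(s) = E e^{-sJ}`, `H` for the Heaviside function. Since `N(t)`
depends only on the durations, it is independent of the statistics, and splitting along `{N(t) = n}`
gives `Q(t) = ∑ P(N(t) = n) a^n` (`IsTransform.tendsto_mixture`). As `P(N(t) = n) = F_n(t) -
F_{n+1}(t)`, summation by parts turns this into `Q(t) = 1 - (1 - a) ∫_0^t h` with `h = ∑ a^n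
f^{*(n+1)}` (`tendsto_sum_measureReal_count`). The series converges for every complex `a`, because
`m(s) → 0` as `s → ∞` and so `|a| m(s) < 1` for some `s`.

The Laplace transform of `h` is `m / (1 - a m)`, and the condition on `Φ` says exactly that `(Φ̂ +
(1 - a)/s) ĥ = 1/s`. So `h` is a resolvent: `Φ * h + (1 - a) H * h = H` (`convPair_resolvent`).
Passing from transforms to distributions uses that a causal distribution whose transform vanishes at
all large real arguments is zero (`CausalDistribution.toFun_eq_zero_of_laplace_eq_zero`): under `u =
e^{-t}` the exponentials become monomials, and polynomials are dense in `C^m[0,1]`.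

The resolvent gives both halves of the Cauchy problem. Existence: `Q' = -(1 - a) h`, so `Φ * Q' =
-(1 - a)(H - (1 - a) H * h) = -(1 - a) Q`. Uniqueness: if `g` is the difference of the derivatives
of two solutions, then `(Φ + (1 - a) H) * g = 0`; convolving with `h` yields `H * g = 0`, which is
the equality of the solutions. All convolutions are handled through their adjoints, the correlations
`corr`. -/

/-! ### Injectivity of the Laplace transform on causal distributions. -/

open Polynomial in
theorem exists_complex_polynomial_near (f : ℝ → ℂ) (hf : Continuous f) (ε : ℝ) (hε : 0 < ε) :
    ∃ p : ℂ[X], ∀ x ∈ Icc (0 : ℝ) 1, ‖f x - p.eval (x : ℂ)‖ ≤ ε := by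
  obtain ⟨p, hp⟩ := exists_polynomial_near_of_continuousOn 0 1 (fun x => (f x).re)
    (Complex.continuous_re.comp hf).continuousOn (ε / 2) (by positivity)
  obtain ⟨q, hq⟩ := exists_polynomial_near_of_continuousOn 0 1 (fun x => (f x).im)
    (Complex.continuous_im.comp hf).continuousOn (ε / 2) (by positivity)
  refine ⟨p.map Complex.ofRealHom + C Complex.I * q.map Complex.ofRealHom, fun x hx => ?_⟩
  have e (r : ℝ[X]) : (r.map Complex.ofRealHom).eval (x : ℂ) = ((r.eval x : ℝ) : ℂ) := by
    rw [eval_map]; exact eval₂_at_apply Complex.ofRealHom x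
  rw [eval_add, eval_mul, eval_C, e, e]
  refine (Complex.norm_le_abs_re_add_abs_im _).trans ?_
  have h1 := hp x hx
  have h2 := hq x hx
  rw [abs_sub_comm] at h1 h2
  simp
  linarith

-- Induction on the order: approximate the derivative by a polynomial and integrate it. The interval
-- has length one, so integration does not enlarge the error.
open Polynomial in
theorem exists_polynomial_near_iteratedDeriv (m : ℕ) : ∀ (f : ℝ → ℂ),
    ContDiff ℝ (⊤ : ℕ∞) f → ∀ ε : ℝ, 0 < ε → ∃ p : ℂ[X], ∀ j ≤ m, ∀ x ∈ Icc (0 : ℝ) 1,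
      ‖iteratedDeriv j (fun x : ℝ => f x - p.eval (x : ℂ)) x‖ ≤ ε := by
  induction m with
  | zero =>
    intro f hf ε hε
    obtain ⟨p, hp⟩ := exists_complex_polynomial_near f hf.continuous ε hε
    refine ⟨p, fun j hj x hx => ?_⟩
    obtain rfl : j = 0 := by omega
    simpa using hp x hx
  | succ m ih =>
    intro f hf ε hε
    have hf' : ContDiff ℝ (⊤ : ℕ∞) (deriv f) := hf.deriv'
    obtain ⟨q, hq⟩ := ih (deriv f) hf' ε hε
    obtain ⟨p₀, hp₀⟩ : ∃ p₀ : ℂ[X], derivative p₀ = q := by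
      refine ⟨∑ i ∈ q.support, C (q.coeff i / (i + 1)) * X ^ (i + 1), ?_⟩
      conv_rhs => rw [q.as_sum_support_C_mul_X_pow]
      rw [derivative_sum]
      refine Finset.sum_congr rfl fun i _ => ?_
      have : (i : ℂ) + 1 ≠ 0 := Nat.cast_add_one_ne_zero i
      rw [derivative_C_mul_X_pow]
      push_cast
      rw [div_mul_cancel₀ _ this]
    -- The constant makes the error vanish at `0`, where the mean value estimate along `y ↦ x * y`
    -- starts.
    set p : ℂ[X] := p₀ + C (f 0 - p₀.eval 0) with hp
    have hpd : derivative p = q := by simp [hp, hp₀]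
    have hder (x : ℝ) : HasDerivAt (fun x : ℝ => f x - p.eval (x : ℂ)) (deriv f x - q.eval (x : ℂ)) x := by
      refine ((hf.differentiable (by simp)) x).hasDerivAt.sub ?_
      rw [← hpd]
      exact (p.hasDerivAt (x : ℂ)).comp_ofReal
    have hder' : deriv (fun x : ℝ => f x - p.eval (x : ℂ)) = fun x : ℝ => deriv f x - q.eval (x : ℂ) :=
      funext fun x => (hder x).deriv
    refine ⟨p, fun j hj x hx => ?_⟩
    rcases j with _ | j
    · have hb := norm_image_sub_le_of_norm_deriv_le_segment_01' (f := fun y : ℝ => (f (x * y) - p.eval ((x * y : ℝ) : ℂ)))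
        (f' := fun y : ℝ => x • (deriv f (x * y) - q.eval ((x * y : ℝ) : ℂ))) (C := ε)
        (fun y _ => by
          have := (hder (x * y)).scomp y ((hasDerivAt_id y).const_mul x)
          exact this.hasDerivWithinAt.congr_deriv (by simp))
        (fun y hy => by
          have := hq 0 (Nat.zero_le _) (x * y) ⟨mul_nonneg hx.1 hy.1, mul_le_one₀ hx.2 hy.1 hy.2.le⟩
          rw [iteratedDeriv_zero] at this
          rw [norm_smul, Real.norm_eq_abs, abs_of_nonneg hx.1]
          exact (mul_le_of_le_one_left (norm_nonneg _) hx.2).trans this)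
      simpa [hp] using hb
    · rw [iteratedDeriv_succ', hder']
      exact hq j (by omega) x hx

theorem contDiff_ofReal_exp (c : ℝ) :
    ContDiff ℝ (⊤ : ℕ∞) (fun t : ℝ => ((Real.exp (c * t) : ℝ) : ℂ)) :=
  Complex.ofRealCLM.contDiff.comp (f := fun t : ℝ => Real.exp (c * t)) (by fun_prop)

theorem contDiff_exp_mul_comp (c : ℝ) {r : ℝ → ℂ} (hr : ContDiff ℝ (⊤ : ℕ∞) r) :
    ContDiff ℝ (⊤ : ℕ∞) (fun t : ℝ => ((Real.exp (-c * t) : ℝ) : ℂ) * r (Real.exp (-t))) := by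
  exact (contDiff_ofReal_exp (-c)).mul (hr.comp (by fun_prop))

/-- The derivatives of `e^{-ct} r(e^{-t})` are controlled by those of `r` on `[0,1]`. -/
theorem exists_bound_iteratedDeriv_exp_mul_comp (j : ℕ) : ∀ c : ℝ, ∃ K : ℝ, 0 ≤ K ∧
    ∀ r : ℝ → ℂ, ContDiff ℝ (⊤ : ℕ∞) r → ∀ ε : ℝ,
      (∀ i ≤ j, ∀ u ∈ Icc (0 : ℝ) 1, ‖iteratedDeriv i r u‖ ≤ ε) → ∀ t : ℝ, 0 ≤ t →
        Real.exp (c * t) * ‖iteratedDeriv j (fun t : ℝ => ((Real.exp (-c * t) : ℝ) : ℂ) * r (Real.exp (-t))) t‖ ≤ K * ε := by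
  have mem (t : ℝ) (ht : 0 ≤ t) : Real.exp (-t) ∈ Icc (0 : ℝ) 1 :=
    ⟨(Real.exp_pos _).le, Real.exp_le_one_iff.2 (by linarith)⟩
  induction j with
  | zero =>
    intro c
    refine ⟨1, zero_le_one, fun r _ ε hε t ht => ?_⟩
    have := hε 0 le_rfl _ (mem t ht)
    rw [iteratedDeriv_zero] at this ⊢
    rw [norm_mul, Complex.norm_real, Real.norm_eq_abs, abs_of_pos (Real.exp_pos _), ← mul_assoc,
      ← Real.exp_add]
    simpa using this
  | succ j ih =>
    intro c
    obtain ⟨K₁, hK₁, h₁⟩ := ih c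
    obtain ⟨K₂, hK₂, h₂⟩ := ih (c + 1)
    refine ⟨|c| * K₁ + K₂, by positivity, fun r hr ε hε t ht => ?_⟩
    have hr' : ContDiff ℝ (⊤ : ℕ∞) (deriv r) := hr.deriv'
    set F₁ := fun t : ℝ => ((Real.exp (-c * t) : ℝ) : ℂ) * r (Real.exp (-t)) with hF₁
    set F₂ := fun t : ℝ => ((Real.exp (-(c + 1) * t) : ℝ) : ℂ) * deriv r (Real.exp (-t)) with hF₂
    -- Differentiation keeps the form `e^{-ct} r(e^{-t})` but raises `c` to `c + 1` in one term;
    -- hence the induction is over all `c` at once.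
    have hd : deriv F₁ = (-c) • F₁ - F₂ := by
      funext t
      have e1 : HasDerivAt (fun t : ℝ => ((Real.exp (-c * t) : ℝ) : ℂ))
          ((Real.exp (-c * t) * (-c * 1) : ℝ) : ℂ) t :=
        (((hasDerivAt_id t).const_mul (-c)).exp).ofReal_comp
      have e2 : HasDerivAt (fun t : ℝ => r (Real.exp (-t))) ((Real.exp (-t) * -1) • deriv r (Real.exp (-t))) t :=
        ((hr.differentiable (by simp) (Real.exp (-t))).hasDerivAt).scomp t (hasDerivAt_neg t).exp
      rw [show deriv F₁ t = _ from (e1.mul e2).deriv]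
      have : Real.exp (-(c + 1) * t) = Real.exp (-c * t) * Real.exp (-t) := by
        rw [← Real.exp_add]; ring_nf
      simp only [hF₁, hF₂, Pi.sub_apply, Pi.smul_apply, this, Complex.real_smul]
      push_cast
      ring
    have c₁ : ContDiff ℝ (⊤ : ℕ∞) F₁ := contDiff_exp_mul_comp c hr
    have c₂ : ContDiff ℝ (⊤ : ℕ∞) F₂ := contDiff_exp_mul_comp (c + 1) hr'
    have d₁ : ContDiffAt ℝ j F₁ t := (c₁.of_le (by exact_mod_cast le_top)).contDiffAt
    have d₂ : ContDiffAt ℝ j F₂ t := (c₂.of_le (by exact_mod_cast le_top)).contDiffAt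
    rw [iteratedDeriv_succ', hd, iteratedDeriv_sub (f := -c • F₁) (d₁.const_smul (-c)) d₂, iteratedDeriv_const_smul d₁]
    have b₁ := h₁ r hr ε (fun i hi => hε i (by omega)) t ht
    have b₂ := h₂ (deriv r) hr' ε (fun i hi u hu => by
      rw [← iteratedDeriv_succ']; exact hε (i + 1) (by omega) u hu) t ht
    have b₃ : Real.exp (c * t) * ‖iteratedDeriv j F₂ t‖ ≤ K₂ * ε :=
      le_trans (mul_le_mul_of_nonneg_right (Real.exp_le_exp.2 (by linarith)) (norm_nonneg _)) b₂
    calc Real.exp (c * t) * ‖-c • iteratedDeriv j F₁ t - iteratedDeriv j F₂ t‖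
        ≤ Real.exp (c * t) * (|c| * ‖iteratedDeriv j F₁ t‖ + ‖iteratedDeriv j F₂ t‖) := by
          gcongr
          refine (norm_sub_le _ _).trans ?_
          rw [norm_smul]; simp
      _ = |c| * (Real.exp (c * t) * ‖iteratedDeriv j F₁ t‖) + Real.exp (c * t) * ‖iteratedDeriv j F₂ t‖ := by ring
      _ ≤ |c| * (K₁ * ε) + K₂ * ε := by gcongr
      _ = _ := by ring

theorem IsDecayTest.add {σ : ℝ} {u v : ℝ → ℂ} (hu : IsDecayTest σ u) (hv : IsDecayTest σ v) :
    IsDecayTest σ (u + v) := by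
  refine ⟨hu.1.add hv.1, fun j => ?_⟩
  obtain ⟨B, hB⟩ := hu.2 j
  obtain ⟨B', hB'⟩ := hv.2 j
  refine ⟨B + B', fun t ht => ?_⟩
  rw [iteratedDeriv_add (hu.1.of_le (by exact_mod_cast le_top)).contDiffAt
    (hv.1.of_le (by exact_mod_cast le_top)).contDiffAt]
  calc _ ≤ Real.exp (σ * t) * (‖iteratedDeriv j u t‖ + ‖iteratedDeriv j v t‖) := by
        gcongr; exact norm_add_le _ _
    _ ≤ _ := by rw [mul_add]; exact add_le_add (hB t ht) (hB' t ht)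

theorem IsDecayTest.const_smul {σ : ℝ} {u : ℝ → ℂ} (c : ℂ) (hu : IsDecayTest σ u) :
    IsDecayTest σ (c • u) := by
  refine ⟨hu.1.const_smul c, fun j => ?_⟩
  obtain ⟨B, hB⟩ := hu.2 j
  refine ⟨‖c‖ * B, fun t ht => ?_⟩
  rw [iteratedDeriv_const_smul (hu.1.of_le (by exact_mod_cast le_top)).contDiffAt, norm_smul, mul_left_comm]
  exact mul_le_mul_of_nonneg_left (hB t ht) (norm_nonneg _)

theorem IsDecayTest.sub {σ : ℝ} {u v : ℝ → ℂ} (hu : IsDecayTest σ u) (hv : IsDecayTest σ v) :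
    IsDecayTest σ (u - v) := by
  have := hu.add (hv.const_smul (-1))
  rwa [neg_one_smul, ← sub_eq_add_neg] at this

theorem CausalDistribution.map_sub (Φ : CausalDistribution) {u v : ℝ → ℂ} (hu : IsDecayTest Φ.σ u)
    (hv : IsDecayTest Φ.σ v) : Φ.toFun (u - v) = Φ.toFun u - Φ.toFun v := by
  have := Φ.map_add _ _ hu (hv.const_smul (-1))
  rwa [Φ.map_smul _ _ hv, neg_one_smul, ← sub_eq_add_neg, neg_one_mul, ← sub_eq_add_neg] at this

theorem isDecayTest_of_hasCompactSupport (σ : ℝ) {θ : ℝ → ℂ} (hθ : ContDiff ℝ (⊤ : ℕ∞) θ)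
    (hc : HasCompactSupport θ) : IsDecayTest σ θ := by
  refine ⟨hθ, fun j => ?_⟩
  have h1 : Continuous (iteratedDeriv j θ) := hθ.continuous_iteratedDeriv j (by exact_mod_cast le_top)
  have h2 : HasCompactSupport (iteratedDeriv j θ) := by
    induction j with
    | zero => simpa using hc
    | succ j ih =>
      rw [iteratedDeriv_succ]
      exact (ih (hθ.continuous_iteratedDeriv j (by exact_mod_cast le_top))).deriv
  have h3 : HasCompactSupport (fun t => Real.exp (σ * t) * ‖iteratedDeriv j θ t‖) := h2.norm.mul_left
  obtain ⟨B, hB⟩ := (show Continuous (fun t => Real.exp (σ * t) * ‖iteratedDeriv j θ t‖) by fun_prop).bounded_above_of_compact_support h3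
  exact ⟨B, fun t _ => (le_abs_self _).trans (hB t)⟩

/-- A smooth compactly supported function is `e^{-ct} ψ(e^{-t})` with `ψ` smooth on the line. -/
theorem exists_smooth_exp_substitution (c : ℝ) {θ : ℝ → ℂ} (hθ : ContDiff ℝ (⊤ : ℕ∞) θ)
    (hc : HasCompactSupport θ) : ∃ ψ : ℝ → ℂ, ContDiff ℝ (⊤ : ℕ∞) ψ ∧
      θ = fun t : ℝ => ((Real.exp (-c * t) : ℝ) : ℂ) * ψ (Real.exp (-t)) := by
  obtain ⟨R, hR⟩ := hc.isCompact.isBounded.subset_closedBall 0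
  have hz : ∀ t, R < t → θ t = 0 := by
    intro t ht
    by_contra hne
    have := hR (subset_tsupport _ hne)
    simp [abs_le] at this
    linarith
  set χ : ℝ → ℂ := fun t => ((Real.exp (c * t) : ℝ) : ℂ) * θ t with hχ
  have hχs : ContDiff ℝ (⊤ : ℕ∞) χ := by
    exact (contDiff_ofReal_exp c).mul hθ
  -- For `u > 0` this is `u^{-c} θ(-log u)`. It vanishes for `u < e^{-R}` because `θ` vanishes
  -- beyond `R`, so the extension by zero is smooth.
  refine ⟨fun u => if 0 < u then χ (-Real.log u) else 0, ?_, ?_⟩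
  · rw [contDiff_iff_contDiffAt]
    intro u
    rcases lt_or_ge 0 u with hu | hu
    · have : (fun u => if 0 < u then χ (-Real.log u) else 0) =ᶠ[𝓝 u] fun u => χ (-Real.log u) := by
        filter_upwards [Ioi_mem_nhds hu] with v hv
        exact if_pos hv
      refine ContDiffAt.congr_of_eventuallyEq ?_ this
      exact hχs.contDiffAt.comp u (Real.contDiffAt_log.2 hu.ne').neg
    · have : (fun u => if 0 < u then χ (-Real.log u) else 0) =ᶠ[𝓝 u] fun _ => 0 := by
        filter_upwards [Iio_mem_nhds (hu.trans_lt (Real.exp_pos (-R)))] with v hv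
        split_ifs with h
        · have : R < -Real.log v := by
            have := (Real.log_lt_iff_lt_exp h).2 hv
            linarith
          simp [hχ, hz _ this]
        · rfl
      exact contDiffAt_const.congr_of_eventuallyEq this
  · funext t
    simp only [Real.exp_pos, if_true, Real.log_exp, neg_neg]
    simp only [hχ]
    rw [← mul_assoc, ← Complex.ofReal_mul, ← Real.exp_add]
    simp

-- The monomial `u^k` becomes `e^{-(c+k)t}`, where the transform vanishes. Membership in the test
-- space travels with the induction because `Ψ` is additive only there.
open Polynomial in
theorem CausalDistribution.toFun_polynomial_exp_eq_zero (Ψ : CausalDistribution) {c : ℝ}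
    (hc : Ψ.σ ≤ c) (hΨ : ∀ s : ℝ, c ≤ s → Ψ.laplace s = 0) (p : ℂ[X]) :
    IsDecayTest Ψ.σ (fun t : ℝ => ((Real.exp (-c * t) : ℝ) : ℂ) * p.eval ((Real.exp (-t) : ℝ) : ℂ)) ∧
    Ψ.toFun (fun t : ℝ => ((Real.exp (-c * t) : ℝ) : ℂ) * p.eval ((Real.exp (-t) : ℝ) : ℂ)) = 0 := by
  induction p using Polynomial.induction_on' with
  | add p q hp hq =>
    have e : (fun t : ℝ => ((Real.exp (-c * t) : ℝ) : ℂ) * (p + q).eval ((Real.exp (-t) : ℝ) : ℂ))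
      = (fun t : ℝ => ((Real.exp (-c * t) : ℝ) : ℂ) * p.eval ((Real.exp (-t) : ℝ) : ℂ))
        + (fun t : ℝ => ((Real.exp (-c * t) : ℝ) : ℂ) * q.eval ((Real.exp (-t) : ℝ) : ℂ)) := by
      funext t; simp [mul_add]
    rw [e, Ψ.map_add _ _ hp.1 hq.1, hp.2, hq.2]
    exact ⟨hp.1.add hq.1, add_zero 0⟩
  | monomial k b =>
    have hs : c ≤ c + k := by simp
    have e : (fun t : ℝ => ((Real.exp (-c * t) : ℝ) : ℂ) * (monomial k b).eval ((Real.exp (-t) : ℝ) : ℂ))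
      = b • (fun t : ℝ => Complex.exp (-((c + k : ℝ) : ℂ) * t)) := by
      funext t
      simp only [eval_monomial, Pi.smul_apply, smul_eq_mul, Complex.ofReal_exp]
      rw [← Complex.exp_nat_mul, mul_left_comm, ← Complex.exp_add]
      push_cast
      ring_nf
    have hd : IsDecayTest Ψ.σ (fun t : ℝ => Complex.exp (-((c + k : ℝ) : ℂ) * t)) :=
      isDecayTest_exp _ _ (by rw [Complex.ofReal_re]; linarith)
    rw [e, Ψ.map_smul _ _ hd]
    refine ⟨hd.const_smul b, ?_⟩
    have := hΨ (c + k) hs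
    unfold CausalDistribution.laplace at this
    rw [this, mul_zero]

/-- A causal distribution is determined by its Laplace transform near `+∞`. -/
theorem CausalDistribution.toFun_eq_zero_of_laplace_eq_zero (Ψ : CausalDistribution)
    (hΨ : ∀ᶠ s : ℝ in atTop, Ψ.laplace s = 0) {θ : ℝ → ℂ} (hθ : ContDiff ℝ (⊤ : ℕ∞) θ)
    (hcθ : HasCompactSupport θ) : Ψ.toFun θ = 0 := by
  obtain ⟨c₀, hc₀⟩ := eventually_atTop.1 hΨ
  set c := max c₀ Ψ.σ
  have hcσ : Ψ.σ ≤ c := le_max_right _ _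
  have hc : ∀ s : ℝ, c ≤ s → Ψ.laplace s = 0 := fun s hs => hc₀ s ((le_max_left _ _).trans hs)
  obtain ⟨ψ, hψ, e⟩ := exists_smooth_exp_substitution c hθ hcθ
  obtain ⟨m, C, hC⟩ := Ψ.bound
  choose K hK0 hK using fun j => exists_bound_iteratedDeriv_exp_mul_comp j c
  set M := ∑ j ∈ Finset.range (m + 1), K j
  have hM : ∀ j ≤ m, K j ≤ M := fun j hj =>
    Finset.single_le_sum (f := K) (fun i _ => hK0 i) (Finset.mem_range.2 (by omega))
  -- `Ψ` kills `e^{-ct} p(e^{-t})`, so `θ` may be replaced by its difference from such a function.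
  -- Approximating `ψ` up to the order `m` of `Ψ` makes that difference small in the norms bounding
  -- `Ψ`.
  have key : ∀ ε : ℝ, 0 < ε → ‖Ψ.toFun θ‖ ≤ C * (M * ε) := by
    intro ε hε
    obtain ⟨p, hp⟩ := exists_polynomial_near_iteratedDeriv m ψ hψ ε hε
    obtain ⟨hE, hE0⟩ := Ψ.toFun_polynomial_exp_eq_zero hcσ hc p
    set E := (fun t : ℝ => ((Real.exp (-c * t) : ℝ) : ℂ) * p.eval ((Real.exp (-t) : ℝ) : ℂ))
    have hθt := isDecayTest_of_hasCompactSupport Ψ.σ hθ hcθ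
    have hr : ContDiff ℝ (⊤ : ℕ∞) (fun x : ℝ => ψ x - p.eval (x : ℂ)) := by
      refine hψ.sub ?_
      have : ContDiff ℝ (⊤ : ℕ∞) (fun z : ℂ => p.eval z) := by
        simpa using (Polynomial.contDiff_aeval (𝕜 := ℂ) p (⊤ : ℕ∞)).restrict_scalars ℝ
      exact this.comp Complex.ofRealCLM.contDiff
    have hdiff : θ - E = fun t : ℝ => ((Real.exp (-c * t) : ℝ) : ℂ) *
        (fun x : ℝ => ψ x - p.eval (x : ℂ)) (Real.exp (-t)) := by
      funext t
      rw [Pi.sub_apply, e]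
      simp only [E]
      ring
    have h0 : Ψ.toFun θ = Ψ.toFun (θ - E) := by rw [Ψ.map_sub hθt hE, hE0, sub_zero]
    rw [h0]
    refine hC _ (hθt.sub hE) _ fun j hj t ht => ?_
    have h1 := hK j _ hr ε (fun i hi u hu => hp i (by omega) u hu) t ht
    rw [← hdiff] at h1
    calc _ ≤ Real.exp (c * t) * ‖iteratedDeriv j (θ - E) t‖ := by gcongr
      _ ≤ K j * ε := h1
      _ ≤ M * ε := by gcongr; exact hM j hj
  have hlim : Tendsto (fun ε : ℝ => C * (M * ε)) (𝓝[>] 0) (𝓝 0) := by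
    have : Tendsto (fun ε : ℝ => C * (M * ε)) (𝓝 0) (𝓝 (C * (M * 0))) := by
      apply Continuous.tendsto; fun_prop
    simpa using this.mono_left nhdsWithin_le_nhds
  exact norm_le_zero_iff.1 (ge_of_tendsto hlim (eventually_mem_nhdsWithin.mono fun ε hε => key ε hε))

/-! ### Correlation of exponentially integrable functions with test functions. -/

/-- The correlation `x ↦ ∫_0^∞ g(y) θ(x + y) dy`. -/
noncomputable def corr (g θ : ℝ → ℂ) (x : ℝ) : ℂ := ∫ y in Ioi (0 : ℝ), g y * θ (x + y)

/-- `h` is integrable on `(0,∞)` against `e^{-ct}`. -/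
def ExpIntegrable (c : ℝ) (h : ℝ → ℂ) : Prop :=
  IntegrableOn (fun t => ((Real.exp (-c * t) : ℝ) : ℂ) * h t) (Ioi 0)

theorem IsDecayTest.mono {σ c : ℝ} (h : σ ≤ c) {θ : ℝ → ℂ} (hθ : IsDecayTest c θ) :
    IsDecayTest σ θ := by
  refine ⟨hθ.1, fun j => ?_⟩
  obtain ⟨B, hB⟩ := hθ.2 j
  refine ⟨B, fun t ht => le_trans ?_ (hB t ht)⟩
  gcongr

theorem IsDecayTest.deriv {c : ℝ} {θ : ℝ → ℂ} (hθ : IsDecayTest c θ) :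
    IsDecayTest c (deriv θ) :=
  ⟨hθ.1.deriv', fun j => by rw [← iteratedDeriv_succ']; exact hθ.2 (j + 1)⟩

/-- The defining bounds concern `t ≥ 0` only; compactness of `[M, 0]` extends them to the left, as
needed for correlations at negative points. -/
theorem IsDecayTest.exists_bound {c : ℝ} {θ : ℝ → ℂ} (hθ : IsDecayTest c θ) (M : ℝ) :
    ∃ B : ℝ, ∀ t, M ≤ t → ‖θ t‖ ≤ B * Real.exp (-c * t) := by
  obtain ⟨B, hB⟩ := hθ.2 0
  have hcont : Continuous (fun t => Real.exp (c * t) * ‖θ t‖) := by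
    have := hθ.1.continuous
    fun_prop
  obtain ⟨B', hB'⟩ := (isCompact_Icc (a := M) (b := 0)).bddAbove_image hcont.continuousOn
  refine ⟨max B B', fun t ht => ?_⟩
  have key : Real.exp (c * t) * ‖θ t‖ ≤ max B B' := by
    rcases le_total 0 t with h | h
    · exact le_max_of_le_left (by simpa using hB t h)
    · exact le_max_of_le_right (hB' ⟨t, ⟨ht, h⟩, rfl⟩)
  calc ‖θ t‖ = (Real.exp (c * t) * ‖θ t‖) * Real.exp (-c * t) := by
        rw [mul_right_comm, ← Real.exp_add]; simp
    _ ≤ _ := by gcongr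

theorem ExpIntegrable.aestronglyMeasurable {c : ℝ} {h : ℝ → ℂ} (hh : ExpIntegrable c h) :
    AEStronglyMeasurable h (volume.restrict (Ioi 0)) := by
  have h1 : AEStronglyMeasurable (fun t : ℝ => ((Real.exp (c * t) : ℝ) : ℂ)) (volume.restrict (Ioi 0)) :=
    (contDiff_ofReal_exp c).continuous.aestronglyMeasurable
  refine (h1.mul (Integrable.aestronglyMeasurable hh)).congr (ae_of_all _ fun t => ?_)
  simp only [Pi.mul_apply]
  rw [← mul_assoc, ← Complex.ofReal_mul, ← Real.exp_add]
  simp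

theorem ExpIntegrable.mono {c c' : ℝ} (hcc : c ≤ c') {h : ℝ → ℂ} (hh : ExpIntegrable c h) :
    ExpIntegrable c' h := by
  refine Integrable.mono hh ((contDiff_ofReal_exp _).continuous.aestronglyMeasurable.mul hh.aestronglyMeasurable) ?_
  refine (ae_restrict_iff' measurableSet_Ioi).2 (ae_of_all _ fun t (ht : 0 < t) => ?_)
  rw [norm_mul, norm_mul, Complex.norm_real, Complex.norm_real, Real.norm_eq_abs, Real.norm_eq_abs,
    abs_of_pos (Real.exp_pos _), abs_of_pos (Real.exp_pos _)]
  gcongr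

/-- Splitting `e^{-c(x+y)}` gives one factor that makes `h` integrable and one that is the decay in
`x`. -/
theorem ExpIntegrable.norm_mul_le {c B x y : ℝ} {h u : ℝ → ℂ}
    (hu : ‖u (x + y)‖ ≤ B * Real.exp (-c * (x + y))) :
    ‖h y * u (x + y)‖ ≤ ‖((Real.exp (-c * y) : ℝ) : ℂ) * h y‖ * (B * Real.exp (-c * x)) := by
  rw [norm_mul, norm_mul, Complex.norm_real, Real.norm_eq_abs, abs_of_pos (Real.exp_pos _)]
  calc _ ≤ ‖h y‖ * (B * Real.exp (-c * (x + y))) := by gcongr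
    _ = _ := by rw [mul_add, Real.exp_add]; ring

theorem ExpIntegrable.integrable_mul {c : ℝ} {h : ℝ → ℂ} (hh : ExpIntegrable c h) {u : ℝ → ℂ}
    (hu : Continuous u) {B x : ℝ} (hB : ∀ t, x ≤ t → ‖u t‖ ≤ B * Real.exp (-c * t)) :
    IntegrableOn (fun y => h y * u (x + y)) (Ioi 0) := by
  refine Integrable.mono' (hh.norm.mul_const (B * Real.exp (-c * x)))
    (hh.aestronglyMeasurable.mul (by fun_prop : Continuous fun y => u (x + y)).aestronglyMeasurable) ?_
  refine (ae_restrict_iff' measurableSet_Ioi).2 (ae_of_all _ fun y (hy : 0 < y) => ?_)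
  exact ExpIntegrable.norm_mul_le (hB _ (by linarith))

theorem ExpIntegrable.norm_corr_le {c : ℝ} {h : ℝ → ℂ} (hh : ExpIntegrable c h) {u : ℝ → ℂ}
    {B x : ℝ} (hB : ∀ t, x ≤ t → ‖u t‖ ≤ B * Real.exp (-c * t)) :
    ‖corr h u x‖ ≤ (∫ y in Ioi (0 : ℝ), ‖((Real.exp (-c * y) : ℝ) : ℂ) * h y‖) * (B * Real.exp (-c * x)) := by
  rw [← integral_mul_const]
  refine norm_integral_le_of_norm_le (hh.norm.mul_const (B * Real.exp (-c * x))) ?_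
  refine (ae_restrict_iff' measurableSet_Ioi).2 (ae_of_all _ fun y (hy : 0 < y) => ?_)
  exact ExpIntegrable.norm_mul_le (hB _ (by linarith))

theorem ExpIntegrable.integrable_corr {c : ℝ} {h : ℝ → ℂ} (hh : ExpIntegrable c h) {θ : ℝ → ℂ}
    (hθ : IsDecayTest c θ) (x : ℝ) : IntegrableOn (fun y => h y * θ (x + y)) (Ioi 0) := by
  obtain ⟨B, hB⟩ := hθ.exists_bound x
  exact hh.integrable_mul hθ.1.continuous hB

theorem ExpIntegrable.hasDerivAt_corr {c : ℝ} {h : ℝ → ℂ} (hh : ExpIntegrable c h) {θ : ℝ → ℂ}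
    (hθ : IsDecayTest c θ) (x : ℝ) : HasDerivAt (corr h θ) (corr h (_root_.deriv θ) x) x := by
  -- The dominating function must serve all points of the unit ball about `x`, hence `x - 1`.
  obtain ⟨B, hB⟩ := hθ.deriv.exists_bound (x - 1)
  have hcont : Continuous (fun z => Real.exp (-c * z)) := by fun_prop
  obtain ⟨E, hE⟩ := (isCompact_closedBall x 1).bddAbove_image hcont.continuousOn
  have hB0 : 0 ≤ B := by
    have := (norm_nonneg _).trans (hB x (by linarith))
    exact nonneg_of_mul_nonneg_left this (Real.exp_pos _)
  refine (hasDerivAt_integral_of_dominated_loc_of_deriv_le (μ := volume.restrict (Ioi 0))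
    (F := fun x y => h y * θ (x + y)) (F' := fun x y => h y * _root_.deriv θ (x + y))
    (bound := fun y => ‖((Real.exp (-c * y) : ℝ) : ℂ) * h y‖ * (B * E))
    (Metric.ball_mem_nhds x one_pos) (Eventually.of_forall fun z => (hh.integrable_corr hθ z).aestronglyMeasurable)
    (hh.integrable_corr hθ x) (hh.integrable_corr hθ.deriv x).aestronglyMeasurable ?_
    (hh.norm.mul_const _) ?_).2
  · refine (ae_restrict_iff' measurableSet_Ioi).2 (ae_of_all _ fun y (hy : 0 < y) z hz => ?_)
    have hz' := Metric.mem_ball.1 hz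
    rw [Real.dist_eq, abs_lt] at hz'
    refine (ExpIntegrable.norm_mul_le (hB (z + y) (by linarith))).trans ?_
    have : Real.exp (-c * z) ≤ E := hE ⟨z, Metric.ball_subset_closedBall hz, rfl⟩
    gcongr
  · refine ae_of_all _ fun y z _ => ?_
    have := ((hθ.1.differentiable (by simp) (z + y)).hasDerivAt).comp_add_const z y
    exact this.const_mul (h y)

theorem ExpIntegrable.iteratedDeriv_corr {c : ℝ} {h : ℝ → ℂ} (hh : ExpIntegrable c h) (j : ℕ) :
    ∀ {θ : ℝ → ℂ}, IsDecayTest c θ → iteratedDeriv j (corr h θ) = corr h (iteratedDeriv j θ) := by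
  induction j with
  | zero => intro θ _; simp
  | succ j ih =>
    intro θ hθ
    rw [iteratedDeriv_succ', iteratedDeriv_succ', ← ih hθ.deriv]
    congr 1
    funext x
    exact (hh.hasDerivAt_corr hθ x).deriv

theorem IsDecayTest.iteratedDeriv {c : ℝ} (j : ℕ) : ∀ {θ : ℝ → ℂ}, IsDecayTest c θ →
    IsDecayTest c (iteratedDeriv j θ) := by
  induction j with
  | zero => intro θ hθ; simpa using hθ
  | succ j ih => intro θ hθ; rw [iteratedDeriv_succ']; exact ih hθ.deriv

theorem ExpIntegrable.iteratedDeriv_corr_le {c : ℝ} {h : ℝ → ℂ} (hh : ExpIntegrable c h)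
    {θ : ℝ → ℂ} (hθ : IsDecayTest c θ) (j : ℕ) {B : ℝ}
    (hB : ∀ t, 0 ≤ t → Real.exp (c * t) * ‖iteratedDeriv j θ t‖ ≤ B) (t : ℝ) (ht : 0 ≤ t) :
    Real.exp (c * t) * ‖iteratedDeriv j (corr h θ) t‖ ≤
      (∫ y in Ioi (0 : ℝ), ‖((Real.exp (-c * y) : ℝ) : ℂ) * h y‖) * B := by
  rw [hh.iteratedDeriv_corr j hθ]
  have h1 := hh.norm_corr_le (u := iteratedDeriv j θ) (B := B) (x := t) fun r hr => by
    calc _ = (Real.exp (c * r) * ‖iteratedDeriv j θ r‖) * Real.exp (-c * r) := by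
          rw [mul_right_comm, ← Real.exp_add]; simp
      _ ≤ _ := by gcongr; exact hB r (ht.trans hr)
  refine (mul_le_mul_of_nonneg_left h1 (Real.exp_pos (c * t)).le).trans_eq ?_
  have : Real.exp (c * t) * Real.exp (-c * t) = 1 := by rw [← Real.exp_add]; simp
  rw [mul_left_comm, mul_left_comm (Real.exp (c * t)), this, mul_one]

theorem ExpIntegrable.isDecayTest_corr {c : ℝ} {h : ℝ → ℂ} (hh : ExpIntegrable c h)
    {θ : ℝ → ℂ} (hθ : IsDecayTest c θ) : IsDecayTest c (corr h θ) := by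
  refine ⟨contDiff_of_differentiable_iteratedDeriv fun j _ x => ?_, fun j => ?_⟩
  · rw [hh.iteratedDeriv_corr j hθ]
    exact (hh.hasDerivAt_corr (hθ.iteratedDeriv j) x).differentiableAt
  · obtain ⟨B, hB⟩ := hθ.2 j
    exact ⟨_, hh.iteratedDeriv_corr_le hθ j hB⟩

theorem ExpIntegrable.corr_add {c : ℝ} {h : ℝ → ℂ} (hh : ExpIntegrable c h) {u v : ℝ → ℂ}
    (hu : IsDecayTest c u) (hv : IsDecayTest c v) : corr h (u + v) = corr h u + corr h v := by
  funext x
  simp only [corr, Pi.add_apply, mul_add]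
  exact integral_add (hh.integrable_corr hu x) (hh.integrable_corr hv x)

theorem corr_const_smul (h u : ℝ → ℂ) (z : ℂ) : corr h (z • u) = z • corr h u := by
  funext x
  simp only [corr, Pi.smul_apply, smul_eq_mul, mul_left_comm _ z]
  exact integral_const_mul _ _

/-- Exponentials are eigenfunctions of the correlation, with the Laplace transform of `h` as
eigenvalue; this is how convolutions become products. -/
theorem corr_exp (h : ℝ → ℂ) (s : ℂ) :
    corr h (fun t : ℝ => Complex.exp (-s * t)) =
      (∫ y in Ioi (0 : ℝ), h y * Complex.exp (-s * y)) • fun t : ℝ => Complex.exp (-s * t) := by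
  funext x
  simp only [corr, Pi.smul_apply, smul_eq_mul]
  rw [← integral_mul_const]
  congr 1
  funext y
  rw [mul_assoc, ← Complex.exp_add]
  push_cast
  ring_nf

theorem integrableOn_exp_neg {c : ℝ} (hc : 0 < c) : IntegrableOn (fun t => Real.exp (-c * t)) (Ioi 0) :=
  exp_neg_integrableOn_Ioi 0 hc

theorem IsDecayTest.integrableOn {c : ℝ} (hc : 0 < c) {θ : ℝ → ℂ} (hθ : IsDecayTest c θ) :
    IntegrableOn θ (Ioi 0) := by
  obtain ⟨B, hB⟩ := hθ.exists_bound 0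
  refine Integrable.mono' ((integrableOn_exp_neg hc).const_mul B) hθ.1.continuous.aestronglyMeasurable ?_
  exact (ae_restrict_iff' measurableSet_Ioi).2 (ae_of_all _ fun y (hy : 0 < y) => hB y hy.le)

theorem norm_integral_le_of_exp_bound {c : ℝ} (hc : 0 < c) {θ : ℝ → ℂ} {B : ℝ}
    (hB : ∀ t, 0 ≤ t → Real.exp (c * t) * ‖θ t‖ ≤ B) : ‖∫ t in Ioi (0 : ℝ), θ t‖ ≤ c⁻¹ * B := by
  have h1 : ‖∫ t in Ioi (0 : ℝ), θ t‖ ≤ ∫ t in Ioi (0 : ℝ), B * Real.exp (-c * t) := by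
    refine norm_integral_le_of_norm_le ((integrableOn_exp_neg hc).const_mul B) ?_
    refine (ae_restrict_iff' measurableSet_Ioi).2 (ae_of_all _ fun t (ht : 0 < t) => ?_)
    calc _ = (Real.exp (c * t) * ‖θ t‖) * Real.exp (-c * t) := by
          rw [mul_right_comm, ← Real.exp_add]; simp
      _ ≤ _ := by gcongr; exact hB t ht.le
  have h2 : ∫ t in Ioi (0 : ℝ), Real.exp (-c * t) = c⁻¹ := by
    rw [integral_exp_mul_Ioi (by linarith) 0]; simp [neg_div_neg_eq]
  rwa [integral_const_mul, h2, mul_comm] at h1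

theorem integral_exp_neg_mul {s : ℝ} (hs : 0 < s) :
    ∫ t in Ioi (0 : ℝ), Complex.exp (-(s : ℂ) * t) = (s : ℂ)⁻¹ := by
  rw [integral_exp_mul_complex_Ioi (by simpa using hs) 0]; simp [neg_div_neg_eq]

/-! ### The resolvent identity. -/

/-- The distribution `Φ * h + (1 - a) H * h - H`, with `H` the Heaviside function. -/
noncomputable def resolventDefect (Φ : CausalDistribution) (a : ℂ) (h : ℝ → ℂ) (c : ℝ) (hc : 0 < c)
    (hσ : Φ.σ ≤ c) (hh : ExpIntegrable c h) : CausalDistribution where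
  σ := c
  toFun θ := Φ.toFun (corr h θ) + (1 - a) * (∫ t in Ioi (0 : ℝ), corr h θ t) - ∫ t in Ioi (0 : ℝ), θ t
  map_add u v hu hv := by
    have hu' := hh.isDecayTest_corr hu
    have hv' := hh.isDecayTest_corr hv
    rw [hh.corr_add hu hv, Φ.map_add _ _ (hu'.mono hσ) (hv'.mono hσ)]
    simp only [Pi.add_apply]
    rw [integral_add (hu'.integrableOn hc) (hv'.integrableOn hc),
      integral_add (hu.integrableOn hc) (hv.integrableOn hc)]
    ring
  map_smul z u hu := by
    rw [corr_const_smul, Φ.map_smul _ _ ((hh.isDecayTest_corr hu).mono hσ)]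
    simp only [Pi.smul_apply, smul_eq_mul]
    rw [integral_const_mul, integral_const_mul]
    ring
  bound := by
    obtain ⟨m, C, hC⟩ := Φ.bound
    set M := ∫ y in Ioi (0 : ℝ), ‖((Real.exp (-c * y) : ℝ) : ℂ) * h y‖
    -- Correlation with `h` costs the factor `M`, and integration over `(0,∞)` against the decay
    -- `e^{-ct}` costs `1/c`.
    refine ⟨m, C * M + ‖1 - a‖ * (c⁻¹ * M) + c⁻¹, fun θ hθ B hB => ?_⟩
    have hB' : ∀ j ≤ m, ∀ t : ℝ, 0 ≤ t → Real.exp (c * t) * ‖iteratedDeriv j (corr h θ) t‖ ≤ M * B :=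
      fun j hj => hh.iteratedDeriv_corr_le hθ j (hB j hj)
    have h1 : ‖Φ.toFun (corr h θ)‖ ≤ C * (M * B) :=
      hC _ ((hh.isDecayTest_corr hθ).mono hσ) _ fun j hj t ht => by
        refine le_trans ?_ (hB' j hj t ht)
        gcongr
    have h2 := norm_integral_le_of_exp_bound hc (θ := corr h θ) (by simpa using hB' 0 (Nat.zero_le _))
    have h3 := norm_integral_le_of_exp_bound hc (θ := θ) (by simpa using hB 0 (Nat.zero_le _))
    calc _ ≤ ‖Φ.toFun (corr h θ)‖ + ‖1 - a‖ * ‖∫ t in Ioi (0 : ℝ), corr h θ t‖ + ‖∫ t in Ioi (0 : ℝ), θ t‖ := by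
          refine (norm_sub_le _ _).trans (add_le_add_left ((norm_add_le _ _).trans ?_) _)
          rw [norm_mul]
      _ ≤ C * (M * B) + ‖1 - a‖ * (c⁻¹ * (M * B)) + c⁻¹ * B := by gcongr
      _ = _ := by ring

/-- The resolvent identity `Φ * h + (1 - a) H * h = H`, tested against smooth functions, follows
from the corresponding identity of Laplace transforms. -/
theorem convPair_resolvent (Φ : CausalDistribution) (a : ℂ) {h : ℝ → ℂ} {c₀ : ℝ}
    (hh : ExpIntegrable c₀ h)
    (hL : ∀ᶠ s : ℝ in atTop, (Φ.laplace s + (1 - a) / s) *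
      (∫ y in Ioi (0 : ℝ), h y * Complex.exp (-(s : ℂ) * y)) = 1 / s)
    {θ : ℝ → ℂ} (hθ : ContDiff ℝ (⊤ : ℕ∞) θ) (hc : HasCompactSupport θ) :
    Φ.convPair h θ + (1 - a) * (∫ t in Ioi (0 : ℝ), corr h θ t) = ∫ t in Ioi (0 : ℝ), θ t := by
  set c := max (max c₀ Φ.σ) 1
  have hc0 : 0 < c := lt_of_lt_of_le one_pos (le_max_right _ _)
  have hσ : Φ.σ ≤ c := (le_max_right _ _).trans (le_max_left _ _)
  have hh' : ExpIntegrable c h := hh.mono ((le_max_left _ _).trans (le_max_left _ _))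
  have key := (resolventDefect Φ a h c hc0 hσ hh').toFun_eq_zero_of_laplace_eq_zero ?_ hθ hc
  · exact sub_eq_zero.1 key
  -- On `e^{-st}` the defect equals `(Φ̂(s) + (1 - a)/s) ĥ(s) - 1/s`.
  filter_upwards [hL, eventually_ge_atTop c] with s hs hcs
  have hs0 : 0 < s := hc0.trans_le hcs
  simp only [CausalDistribution.laplace, resolventDefect] at hs ⊢
  rw [corr_exp, Φ.map_smul _ _ (isDecayTest_exp _ _ (by rw [Complex.ofReal_re]; exact hσ.trans hcs))]
  simp only [Pi.smul_apply, smul_eq_mul]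
  rw [integral_const_mul, integral_exp_neg_mul hs0]
  linear_combination hs

/-! ### Absolute continuity for complex-valued functions. -/

section AbsolutelyContinuous

/-- The sums of increments are dominated termwise. This transfers absolute continuity between a
complex function and its real and imaginary parts, where the real theory applies. -/
theorem absolutelyContinuousOnInterval_of_dist_le {E F : Type*} [PseudoMetricSpace E] [PseudoMetricSpace F]
    {f : ℝ → E} {u v : ℝ → F} {a b : ℝ} (hu : AbsolutelyContinuousOnInterval u a b)
    (hv : AbsolutelyContinuousOnInterval v a b)
    (h : ∀ x ∈ uIcc a b, ∀ y ∈ uIcc a b, dist (f x) (f y) ≤ dist (u x) (u y) + dist (v x) (v y)) :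
    AbsolutelyContinuousOnInterval f a b := by
  have h0 := Tendsto.add hu hv
  rw [add_zero] at h0
  refine squeeze_zero' (Eventually.of_forall fun E => Finset.sum_nonneg fun _ _ => dist_nonneg) ?_ h0
  filter_upwards [eventually_inf_principal.mpr (Eventually.of_forall fun _ h => h)] with E hE
  rw [← Finset.sum_add_distrib]
  exact Finset.sum_le_sum fun i hi => h _ (hE.1 i hi).1 _ (hE.1 i hi).2

theorem AbsolutelyContinuousOnInterval.re {q : ℝ → ℂ} {a b : ℝ} (hq : AbsolutelyContinuousOnInterval q a b) :
    AbsolutelyContinuousOnInterval (fun x => (q x).re) a b :=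
  absolutelyContinuousOnInterval_of_dist_le hq hq fun x _ y _ => by
    have : dist (q x).re (q y).re ≤ dist (q x) (q y) := by
      rw [Real.dist_eq, dist_eq_norm, ← Complex.sub_re]; exact Complex.abs_re_le_norm _
    linarith [dist_nonneg (x := q x) (y := q y)]

theorem AbsolutelyContinuousOnInterval.im {q : ℝ → ℂ} {a b : ℝ} (hq : AbsolutelyContinuousOnInterval q a b) :
    AbsolutelyContinuousOnInterval (fun x => (q x).im) a b :=
  absolutelyContinuousOnInterval_of_dist_le hq hq fun x _ y _ => by
    have : dist (q x).im (q y).im ≤ dist (q x) (q y) := by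
      rw [Real.dist_eq, dist_eq_norm, ← Complex.sub_im]; exact Complex.abs_im_le_norm _
    linarith [dist_nonneg (x := q x) (y := q y)]

theorem absolutelyContinuousOnInterval_of_re_im {q : ℝ → ℂ} {a b : ℝ}
    (h₁ : AbsolutelyContinuousOnInterval (fun x => (q x).re) a b)
    (h₂ : AbsolutelyContinuousOnInterval (fun x => (q x).im) a b) :
    AbsolutelyContinuousOnInterval q a b :=
  absolutelyContinuousOnInterval_of_dist_le h₁ h₂ fun x _ y _ => by
    rw [Real.dist_eq, Real.dist_eq, dist_eq_norm, ← Complex.sub_re, ← Complex.sub_im]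
    exact Complex.norm_le_abs_re_add_abs_im _

theorem AbsolutelyContinuousOnInterval.congr {E : Type*} [PseudoMetricSpace E] {f g : ℝ → E} {a b : ℝ}
    (hf : AbsolutelyContinuousOnInterval f a b) (h : ∀ x ∈ uIcc a b, g x = f x) :
    AbsolutelyContinuousOnInterval g a b :=
  absolutelyContinuousOnInterval_of_dist_le hf hf fun x hx y hy => by
    rw [h x hx, h y hy]
    linarith [dist_nonneg (x := f x) (y := f y)]

theorem absolutelyContinuousOnInterval_integral {g : ℝ → ℂ} {a b : ℝ} (hg : IntervalIntegrable g volume a b) :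
    AbsolutelyContinuousOnInterval (fun x => ∫ t in a..x, g t) a b := by
  have hsub : ∀ x ∈ uIcc a b, IntervalIntegrable g volume a x := fun x hx =>
    hg.mono_set (uIcc_subset_uIcc_left hx)
  have hre : IntervalIntegrable (fun t => (g t).re) volume a b := ⟨hg.1.re, hg.2.re⟩
  have him : IntervalIntegrable (fun t => (g t).im) volume a b := ⟨hg.1.im, hg.2.im⟩
  refine absolutelyContinuousOnInterval_of_re_im
    (AbsolutelyContinuousOnInterval.congr
      (hre.absolutelyContinuousOnInterval_intervalIntegral left_mem_uIcc) fun x hx => ?_)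
    (AbsolutelyContinuousOnInterval.congr
      (him.absolutelyContinuousOnInterval_intervalIntegral left_mem_uIcc) fun x hx => ?_)
  · exact (Complex.reCLM.intervalIntegral_comp_comm (hsub x hx)).symm
  · exact (Complex.imCLM.intervalIntegral_comp_comm (hsub x hx)).symm

theorem AbsolutelyContinuousOnInterval.deriv_ae_eq {q : ℝ → ℂ} {a b : ℝ} (hq : AbsolutelyContinuousOnInterval q a b) :
    ∀ᵐ x, x ∈ uIcc a b → deriv q x =
      ((deriv (fun x => (q x).re) x : ℝ) : ℂ) + ((deriv (fun x => (q x).im) x : ℝ) : ℂ) * Complex.I := by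
  filter_upwards [(AbsolutelyContinuousOnInterval.re hq).ae_differentiableAt,
    (AbsolutelyContinuousOnInterval.im hq).ae_differentiableAt] with x h1 h2 hx
  have e1 := (h1 hx).hasDerivAt.ofReal_comp
  have e2 := ((h2 hx).hasDerivAt.ofReal_comp).mul_const Complex.I
  have := e1.add e2
  refine (HasDerivAt.congr_of_eventuallyEq this (Eventually.of_forall fun y => ?_)).deriv
  exact (Complex.re_add_im (q y)).symm

theorem intervalIntegrable_ofReal {f : ℝ → ℝ} {a b : ℝ} (hf : IntervalIntegrable f volume a b) :
    IntervalIntegrable (fun x => (f x : ℂ)) volume a b := ⟨hf.1.ofReal, hf.2.ofReal⟩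

theorem AbsolutelyContinuousOnInterval.intervalIntegrable_deriv_complex {q : ℝ → ℂ} {a b : ℝ}
    (hq : AbsolutelyContinuousOnInterval q a b) : IntervalIntegrable (deriv q) volume a b := by
  have h1 := (AbsolutelyContinuousOnInterval.re hq).intervalIntegrable_deriv
  have h2 := (AbsolutelyContinuousOnInterval.im hq).intervalIntegrable_deriv
  have h3 := (intervalIntegrable_ofReal h1).add ((intervalIntegrable_ofReal h2).mul_const Complex.I)
  refine h3.congr_ae ?_
  refine (ae_restrict_iff' measurableSet_uIoc).2 ?_
  filter_upwards [AbsolutelyContinuousOnInterval.deriv_ae_eq hq] with x hx hxm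
  exact (hx (uIoc_subset_uIcc hxm)).symm

theorem AbsolutelyContinuousOnInterval.integral_deriv_eq_sub_complex {q : ℝ → ℂ} {a b : ℝ}
    (hq : AbsolutelyContinuousOnInterval q a b) : ∫ x in a..b, deriv q x = q b - q a := by
  have h1 := (AbsolutelyContinuousOnInterval.re hq).intervalIntegrable_deriv
  have h2 := (AbsolutelyContinuousOnInterval.im hq).intervalIntegrable_deriv
  have e : ∫ x in a..b, deriv q x = ∫ x in a..b, (((deriv (fun x => (q x).re) x : ℝ) : ℂ) +
      ((deriv (fun x => (q x).im) x : ℝ) : ℂ) * Complex.I) := by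
    refine intervalIntegral.integral_congr_ae ?_
    filter_upwards [AbsolutelyContinuousOnInterval.deriv_ae_eq hq] with x hx hxm
    exact hx (uIoc_subset_uIcc hxm)
  rw [e, intervalIntegral.integral_add (intervalIntegrable_ofReal h1)
    ((intervalIntegrable_ofReal h2).mul_const Complex.I), intervalIntegral.integral_mul_const]
  have i1 := intervalIntegral.integral_ofReal (μ := volume) (a := a) (b := b) (f := deriv (fun x => (q x).re))
  have i2 := intervalIntegral.integral_ofReal (μ := volume) (a := a) (b := b) (f := deriv (fun x => (q x).im))
  rw [(AbsolutelyContinuousOnInterval.re hq).integral_deriv_eq_sub] at i1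
  rw [(AbsolutelyContinuousOnInterval.im hq).integral_deriv_eq_sub] at i2
  erw [i1, i2]
  apply Complex.ext <;> simp

end AbsolutelyContinuous

/-! ### Convolution calculus on the half-line, and uniqueness. -/

/-- Local integrability on `[0,∞)`. -/
def HalfLocInt (g : ℝ → ℂ) : Prop := ∀ M : ℝ, IntegrableOn g (Ioc 0 M)

theorem HalfLocInt.intervalIntegrable {g : ℝ → ℂ} (hg : HalfLocInt g) {t : ℝ} (ht : 0 ≤ t) :
    IntervalIntegrable g volume 0 t := (intervalIntegrable_iff_integrableOn_Ioc_of_le ht).2 (hg t)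

theorem HalfLocInt.aestronglyMeasurable {g : ℝ → ℂ} (hg : HalfLocInt g) :
    AEStronglyMeasurable g (volume.restrict (Ioi 0)) := by
  have : Ioi (0 : ℝ) = ⋃ n : ℕ, Ioc 0 (n : ℝ) := by
    ext x
    simp only [mem_Ioi, mem_iUnion, mem_Ioc, exists_and_left, iff_self_and]
    exact fun _ => exists_nat_ge x
  rw [this]
  exact AEStronglyMeasurable.iUnion fun n => (hg n).aestronglyMeasurable

theorem HalfLocInt.sub {g h : ℝ → ℂ} (hg : HalfLocInt g) (hh : HalfLocInt h) : HalfLocInt (g - h) :=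
  fun M => (hg M).sub (hh M)

theorem HalfLocInt.locallyIntegrable {g : ℝ → ℂ} (hg : HalfLocInt g) :
    LocallyIntegrable ((Ioi 0).indicator g) volume := by
  rw [locallyIntegrable_iff]
  intro k hk
  obtain ⟨R, hR⟩ := hk.isBounded.subset_closedBall 0
  refine IntegrableOn.mono_set ?_ hR
  rw [IntegrableOn, integrable_indicator_iff measurableSet_Ioi, IntegrableOn,
    Measure.restrict_restrict measurableSet_Ioi]
  refine (hg R).mono_set fun x hx => ?_
  have := hx.2
  rw [Metric.mem_closedBall, Real.dist_eq, sub_zero, abs_le] at this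
  exact ⟨hx.1, this.2⟩

theorem ExpIntegrable.halfLocInt {c : ℝ} {h : ℝ → ℂ} (hh : ExpIntegrable c h) : HalfLocInt h := by
  intro M
  have h1 : IntegrableOn (fun t => ((Real.exp (-c * t) : ℝ) : ℂ) * h t) (Ioc 0 M) :=
    IntegrableOn.mono_set hh fun x hx => hx.1
  have hcont : Continuous (fun t => Real.exp (c * t)) := by fun_prop
  obtain ⟨E, hE⟩ := (isCompact_Icc (a := 0) (b := M)).bddAbove_image hcont.continuousOn
  refine (Integrable.bdd_mul h1 (f := fun t : ℝ => ((Real.exp (c * t) : ℝ) : ℂ))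
    (contDiff_ofReal_exp c).continuous.aestronglyMeasurable (c := E) ?_).congr (ae_of_all _ fun t => ?_)
  · refine (ae_restrict_iff' measurableSet_Ioc).2 (ae_of_all _ fun t ht => ?_)
    rw [Complex.norm_real, Real.norm_eq_abs, abs_of_pos (Real.exp_pos _)]
    exact hE ⟨t, Ioc_subset_Icc_self ht, rfl⟩
  · simp only
    rw [← mul_assoc, ← Complex.ofReal_mul, ← Real.exp_add]
    simp

theorem HalfLocInt.integrableOn_indicator {g : ℝ → ℂ} (hg : HalfLocInt g) (M : ℝ) :
    IntegrableOn ((Iic M).indicator g) (Ioi 0) := by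
  rw [IntegrableOn, integrable_indicator_iff measurableSet_Iic, IntegrableOn,
    Measure.restrict_restrict measurableSet_Iic]
  exact (hg M).mono_set fun x hx => ⟨hx.2, hx.1⟩

/-- With `θ` zero beyond `R` and both variables positive, the integrand vanishes unless each is at
most `R - x`. Both functions can be truncated there, so no growth condition is needed. -/
theorem integrable_corr_prod {g h θ : ℝ → ℂ} (hg : HalfLocInt g) (hh : HalfLocInt h)
    (hθ : Continuous θ) (hc : HasCompactSupport θ) (x : ℝ) :
    Integrable (fun p : ℝ × ℝ => g p.1 * (h p.2 * θ (x + p.1 + p.2)))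
      ((volume.restrict (Ioi 0)).prod (volume.restrict (Ioi 0))) := by
  obtain ⟨R, hR⟩ := hc.isCompact.isBounded.subset_closedBall 0
  obtain ⟨B, hB⟩ := hθ.bounded_above_of_compact_support hc
  have h1 := (hg.integrableOn_indicator (R - x)).mul_prod (hh.integrableOn_indicator (R - x))
  have h2 := h1.mul_bdd (g := fun p : ℝ × ℝ => θ (x + p.1 + p.2)) (c := B)
    (by fun_prop : Continuous fun p : ℝ × ℝ => θ (x + p.1 + p.2)).aestronglyMeasurable
    (ae_of_all _ fun p => hB _)
  refine h2.congr ?_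
  rw [Measure.prod_restrict]
  refine (ae_restrict_iff' (measurableSet_Ioi.prod measurableSet_Ioi)).2 (ae_of_all _ fun p hp => ?_)
  have hp1 : 0 < p.1 := hp.1
  have hp2 : 0 < p.2 := hp.2
  by_cases h0 : θ (x + p.1 + p.2) = 0
  · simp [h0]
  · have := hR (subset_tsupport _ h0)
    rw [Metric.mem_closedBall, Real.dist_eq, sub_zero, abs_le] at this
    have m1 : p.1 ∈ Iic (R - x) := by rw [mem_Iic]; linarith
    have m2 : p.2 ∈ Iic (R - x) := by rw [mem_Iic]; linarith
    simp only [indicator_of_mem m1, indicator_of_mem m2, mul_assoc]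

/-- The adjoint form of `g * h = h * g`, by Fubini. -/
theorem corr_comm {g h θ : ℝ → ℂ} (hg : HalfLocInt g) (hh : HalfLocInt h)
    (hθ : Continuous θ) (hc : HasCompactSupport θ) : corr g (corr h θ) = corr h (corr g θ) := by
  funext x
  simp only [corr, ← integral_const_mul]
  rw [integral_integral_swap (integrable_corr_prod hg hh hθ hc x)]
  congr 1; funext v
  congr 1; funext y
  rw [mul_left_comm, add_right_comm]

theorem setIntegral_Ioi_comp_add (f : ℝ → ℂ) (y : ℝ) :
    ∫ x in Ioi (0 : ℝ), f (y + x) = ∫ t in Ioi y, f t := by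
  have := (measurePreserving_add_left volume y).setIntegral_preimage_emb
    (measurableEmbedding_addLeft y) f (Ioi y)
  rw [← this]
  simp

/-- Both sides pair `H * g` with `θ`: `corr_comm` with the constant `1` produces tail integrals of
`θ`, and Fubini moves the integration onto `g`. -/
theorem setIntegral_corr {g θ : ℝ → ℂ} (hg : HalfLocInt g) (hθ : Continuous θ) (hc : HasCompactSupport θ) :
    ∫ x in Ioi (0 : ℝ), corr g θ x = ∫ t in Ioi (0 : ℝ), (∫ y in (0 : ℝ)..t, g y) * θ t := by
  have h1 : HalfLocInt (fun _ => 1) := fun M => by simp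
  have e1 : ∫ x in Ioi (0 : ℝ), corr g θ x = ∫ y in Ioi (0 : ℝ), g y * ∫ t in Ioi y, θ t := by
    have := congrFun (corr_comm h1 hg hθ hc) 0
    simp only [corr, one_mul, zero_add] at this
    refine this.trans ?_
    refine setIntegral_congr_fun measurableSet_Ioi fun y _ => ?_
    exact congrArg (g y * ·) (setIntegral_Ioi_comp_add θ y)
  obtain ⟨R, hR⟩ := hc.isCompact.isBounded.subset_closedBall 0
  have hint : Integrable (fun p : ℝ × ℝ => g p.1 * (Ioi p.1).indicator θ p.2)
      ((volume.restrict (Ioi 0)).prod (volume.restrict (Ioi 0))) := by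
    have h2 := (hg.integrableOn_indicator R).mul_prod ((hθ.integrable_of_hasCompactSupport hc (μ := volume)).restrict (s := Ioi 0))
    have hm : MeasurableSet {p : ℝ × ℝ | p.1 < p.2} := measurableSet_lt measurable_fst measurable_snd
    refine (h2.indicator hm).congr ?_
    rw [Measure.prod_restrict]
    refine (ae_restrict_iff' (measurableSet_Ioi.prod measurableSet_Ioi)).2 (ae_of_all _ fun p hp => ?_)
    by_cases h0 : θ p.2 = 0
    · simp [indicator, h0]
    · have := hR (subset_tsupport _ h0)
      rw [Metric.mem_closedBall, Real.dist_eq, sub_zero, abs_le] at this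
      by_cases hlt : p.1 < p.2
      · have m1 : p.1 ≤ R := by linarith
        simp [indicator, hlt, m1]
      · simp [indicator, hlt]
  calc _ = ∫ y in Ioi (0 : ℝ), ∫ t in Ioi (0 : ℝ), g y * (Ioi y).indicator θ t := by
        rw [e1]
        refine setIntegral_congr_fun measurableSet_Ioi fun y (hy : 0 < y) => ?_
        rw [integral_const_mul, integral_indicator measurableSet_Ioi,
          Measure.restrict_restrict measurableSet_Ioi, inter_eq_left.2 (Ioi_subset_Ioi hy.le)]
    _ = ∫ t in Ioi (0 : ℝ), ∫ y in Ioi (0 : ℝ), g y * (Ioi y).indicator θ t :=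
        integral_integral_swap hint
    _ = _ := by
        refine setIntegral_congr_fun measurableSet_Ioi fun t (ht : 0 < t) => ?_
        have : ∀ y, g y * (Ioi y).indicator θ t = (Iio t).indicator g y * θ t := by
          intro y
          by_cases h : y < t <;> simp [indicator, h]
        simp only [this]
        rw [integral_mul_const, integral_indicator measurableSet_Iio,
          Measure.restrict_restrict measurableSet_Iio, intervalIntegral.integral_of_le ht.le,
          integral_Ioc_eq_integral_Ioo, inter_comm]
        rfl

/-- A correlation `corr g θ` vanishes far to the right but not to the left. Cutting it off between
`-2` and `-1` makes it an admissible test function, unchanged near `[0,∞)`. -/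
theorem exists_cutoff {u : ℝ → ℂ} (hu : ContDiff ℝ (⊤ : ℕ∞) u) {R : ℝ} (hR : ∀ t, R < t → u t = 0) :
    ∃ v : ℝ → ℂ, ContDiff ℝ (⊤ : ℕ∞) v ∧ HasCompactSupport v ∧ ∀ t, -1 < t → v t = u t := by
  refine ⟨fun t => ((Real.smoothTransition (t + 2) : ℝ) : ℂ) * u t, ?_, ?_, fun t ht => ?_⟩
  · have h1 : ContDiff ℝ (⊤ : ℕ∞) (fun t : ℝ => Real.smoothTransition (t + 2)) :=
      Real.smoothTransition.contDiff.comp (by fun_prop)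
    have h2 : ContDiff ℝ (⊤ : ℕ∞) (fun t : ℝ => ((Real.smoothTransition (t + 2) : ℝ) : ℂ)) :=
      Complex.ofRealCLM.contDiff.comp h1
    exact h2.mul hu
  · refine HasCompactSupport.intro (isCompact_Icc (a := -2) (b := R)) fun t ht => ?_
    rcases lt_or_ge t (-2) with h | h
    · rw [Real.smoothTransition.zero_of_nonpos (by linarith)]; simp
    · rw [hR t (by by_contra h'; exact ht ⟨h, not_lt.1 h'⟩), mul_zero]
  · simp only
    rw [Real.smoothTransition.one_of_one_le (by linarith)]; simp

/-- Agreement on an open neighbourhood of `[0,∞)` forces agreement of all derivatives there, so the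
continuity bound applies to the difference with `B = 0`. -/
theorem CausalDistribution.toFun_congr (Φ : CausalDistribution) {u v : ℝ → ℂ} (hu : IsDecayTest Φ.σ u)
    (hv : IsDecayTest Φ.σ v) (h : ∀ t, -1 < t → u t = v t) : Φ.toFun u = Φ.toFun v := by
  obtain ⟨m, C, hC⟩ := Φ.bound
  have h0 := hC (u - v) (hu.sub hv) 0 fun j _ t ht => by
    have : u - v =ᶠ[𝓝 t] fun _ => 0 := by
      filter_upwards [Ioi_mem_nhds (show -1 < t by linarith)] with r hr
      simp [h r hr]
    rw [this.iteratedDeriv_eq]; simp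
  rw [mul_zero, Φ.map_sub hu hv] at h0
  exact sub_eq_zero.1 (norm_le_zero_iff.1 h0)

theorem exists_eq_zero_of_lt {θ : ℝ → ℂ} (hc : HasCompactSupport θ) :
    ∃ R : ℝ, ∀ t, R < t → θ t = 0 := by
  obtain ⟨R, hR⟩ := hc.isCompact.isBounded.subset_closedBall 0
  refine ⟨R, fun t ht => ?_⟩
  by_contra hne
  have := hR (subset_tsupport _ hne)
  rw [Metric.mem_closedBall, Real.dist_eq, sub_zero, abs_le] at this
  linarith

theorem HalfLocInt.isDecayTest_corr {g θ : ℝ → ℂ} (hg : HalfLocInt g) (hθ : ContDiff ℝ (⊤ : ℕ∞) θ)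
    (hc : HasCompactSupport θ) (σ : ℝ) : IsDecayTest σ (corr g θ) :=
  isDecayTest_conv g θ hg.locallyIntegrable hθ hc σ

theorem corr_eq_zero {θ : ℝ → ℂ} {R : ℝ} (hR : ∀ t, R < t → θ t = 0) (g : ℝ → ℂ) (t : ℝ) (ht : R < t) :
    corr g θ t = 0 :=
  setIntegral_eq_zero_of_forall_eq_zero fun y (hy : 0 < y) => by rw [hR _ (by linarith), mul_zero]

theorem corr_congr_right {u v : ℝ → ℂ} (h : ∀ t, -1 < t → u t = v t) (g : ℝ → ℂ) (t : ℝ) (ht : -1 < t) :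
    corr g u t = corr g v t :=
  setIntegral_congr_fun measurableSet_Ioi fun y (hy : 0 < y) => by
    rw [h _ (by linarith)]

theorem corr_congr_left {g h : ℝ → ℂ} (hgh : g =ᵐ[volume.restrict (Ioi 0)] h) (θ : ℝ → ℂ) :
    corr g θ = corr h θ := by
  funext x
  exact integral_congr_ae (hgh.mono fun y hy => by simp only; rw [hy])

theorem HalfLocInt.integrableOn_mul {g u : ℝ → ℂ} (hg : HalfLocInt g) (hu : Continuous u)
    (hc : HasCompactSupport u) : IntegrableOn (fun y => g y * u y) (Ioi 0) := by
  obtain ⟨R, hR⟩ := exists_eq_zero_of_lt hc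
  obtain ⟨B, hB⟩ := hu.bounded_above_of_compact_support hc
  refine ((hg.integrableOn_indicator R).mul_bdd hu.aestronglyMeasurable (ae_of_all _ hB)).congr
    (ae_of_all _ fun y => ?_)
  by_cases h : y ≤ R
  · simp [indicator, h]
  · simp [hR y (not_le.1 h)]

theorem HalfLocInt.corr_sub {g h θ : ℝ → ℂ} (hg : HalfLocInt g) (hh : HalfLocInt h) (hθ : Continuous θ)
    (hc : HasCompactSupport θ) : corr (g - h) θ = corr g θ - corr h θ := by
  funext x
  have hc' : HasCompactSupport (fun y => θ (x + y)) := hc.comp_homeomorph (Homeomorph.addLeft x)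
  simp only [corr, Pi.sub_apply, sub_mul]
  exact integral_sub (hg.integrableOn_mul (by fun_prop) hc') (hh.integrableOn_mul (by fun_prop) hc')

theorem SolvesRelaxation.halfLocInt_deriv {Φ : CausalDistribution} {a : ℂ} {q : ℝ → ℂ}
    (hq : SolvesRelaxation Φ a q) : HalfLocInt (deriv q) := by
  intro M
  rcases le_total 0 M with h | h
  · exact (intervalIntegrable_iff_integrableOn_Ioc_of_le h).1
      (AbsolutelyContinuousOnInterval.intervalIntegrable_deriv_complex (hq.absCont M h))
  · simp [Ioc_eq_empty (not_lt.2 h)]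

theorem SolvesRelaxation.integral_deriv {Φ : CausalDistribution} {a : ℂ} {q : ℝ → ℂ}
    (hq : SolvesRelaxation Φ a q) {t : ℝ} (ht : 0 ≤ t) : ∫ y in (0 : ℝ)..t, deriv q y = q t - 1 := by
  rw [AbsolutelyContinuousOnInterval.integral_deriv_eq_sub_complex (hq.absCont t ht), hq.initial]

theorem SolvesRelaxation.continuousOn {Φ : CausalDistribution} {a : ℂ} {q : ℝ → ℂ}
    (hq : SolvesRelaxation Φ a q) {t : ℝ} (ht : 0 ≤ t) : ContinuousOn q (Icc 0 t) := by
  have := (hq.absCont t ht).continuousOn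
  rwa [uIcc_of_le ht] at this

theorem SolvesRelaxation.halfLocInt {Φ : CausalDistribution} {a : ℂ} {q : ℝ → ℂ}
    (hq : SolvesRelaxation Φ a q) : HalfLocInt q := by
  intro M
  rcases le_total 0 M with h | h
  · exact (hq.continuousOn h).integrableOn_Icc.mono_set Ioc_subset_Icc_self
  · simp [Ioc_eq_empty (not_lt.2 h)]

theorem HalfLocInt.ae_eq_zero {d : ℝ → ℂ} (hd : HalfLocInt d)
    (h : ∀ η : ℝ → ℂ, ContDiff ℝ (⊤ : ℕ∞) η → HasCompactSupport η → ∫ t in Ioi (0 : ℝ), d t * η t = 0) :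
    ∀ᵐ t : ℝ, 0 < t → d t = 0 := by
  have := ae_eq_zero_of_integral_contDiff_smul_eq_zero hd.locallyIntegrable fun g hg hgc => by
    have h1 := h (fun t => (g t : ℂ)) (Complex.ofRealCLM.contDiff.comp hg)
      (hgc.comp_left Complex.ofReal_zero)
    rw [← h1, ← integral_indicator measurableSet_Ioi]
    congr 1
    funext t
    by_cases ht : t ∈ Ioi (0 : ℝ)
    · simp [indicator_of_mem ht, mul_comm]
    · simp [indicator_of_notMem ht]
  filter_upwards [this] with t ht h0
  rwa [indicator_of_mem (mem_Ioi.2 h0)] at ht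

/-- Uniqueness for the relaxation equation, from the existence of a resolvent. -/
theorem SolvesRelaxation.unique {Φ : CausalDistribution} {a : ℂ} {h : ℝ → ℂ} (hh : HalfLocInt h)
    (hres : ∀ θ : ℝ → ℂ, ContDiff ℝ (⊤ : ℕ∞) θ → HasCompactSupport θ →
      Φ.convPair h θ + (1 - a) * (∫ t in Ioi (0 : ℝ), corr h θ t) = ∫ t in Ioi (0 : ℝ), θ t)
    {q₁ q₂ : ℝ → ℂ} (h₁ : SolvesRelaxation Φ a q₁) (h₂ : SolvesRelaxation Φ a q₂) (t : ℝ)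
    (ht : 0 ≤ t) : q₁ t = q₂ t := by
  set g := deriv q₁ - deriv q₂ with hg_def
  have hg : HalfLocInt g := h₁.halfLocInt_deriv.sub h₂.halfLocInt_deriv
  have hgint : ∀ t : ℝ, 0 ≤ t → ∫ y in (0 : ℝ)..t, g y = q₁ t - q₂ t := by
    intro t ht
    have := intervalIntegral.integral_sub (h₁.halfLocInt_deriv.intervalIntegrable ht)
      (h₂.halfLocInt_deriv.intervalIntegrable ht)
    rw [h₁.integral_deriv ht, h₂.integral_deriv ht] at this
    simp only [hg_def, Pi.sub_apply]
    rw [this]; ring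
  have hcorr : ∀ θ : ℝ → ℂ, ContDiff ℝ (⊤ : ℕ∞) θ → HasCompactSupport θ →
      ∫ t in Ioi (0 : ℝ), corr g θ t = ∫ t in Ioi (0 : ℝ), (q₁ t - q₂ t) * θ t := by
    intro θ hθ hc
    rw [setIntegral_corr hg hθ.continuous hc]
    exact setIntegral_congr_fun measurableSet_Ioi fun t (ht : 0 < t) => by
      rw [hgint t ht.le]
  -- This is `(Φ + (1 - a) H) * g = 0`; the equal initial values make `H * g` equal to `q₁ - q₂`.
  have hE : ∀ θ : ℝ → ℂ, ContDiff ℝ (⊤ : ℕ∞) θ → HasCompactSupport θ →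
      Φ.toFun (corr g θ) + (1 - a) * ∫ t in Ioi (0 : ℝ), corr g θ t = 0 := by
    intro θ hθ hc
    have e1 : Φ.toFun (corr (deriv q₁) θ) = _ := h₁.equation θ hθ hc
    have e2 : Φ.toFun (corr (deriv q₂) θ) = _ := h₂.equation θ hθ hc
    rw [hcorr θ hθ hc, hg_def,
      HalfLocInt.corr_sub h₁.halfLocInt_deriv h₂.halfLocInt_deriv hθ.continuous hc,
      Φ.map_sub (h₁.halfLocInt_deriv.isDecayTest_corr hθ hc _)
        (h₂.halfLocInt_deriv.isDecayTest_corr hθ hc _), e1, e2]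
    simp only [sub_mul]
    rw [integral_sub (h₁.halfLocInt.integrableOn_mul hθ.continuous hc)
      (h₂.halfLocInt.integrableOn_mul hθ.continuous hc)]
    ring
  have hz : ∀ᵐ t : ℝ, 0 < t → q₁ t - q₂ t = 0 := by
    -- Testing `hE` against a cutoff of `corr h η` amounts to convolving it with `h`. By
    -- commutativity this is the resolvent identity tested against a cutoff of `corr g η`, which
    -- leaves the pairing of `H * g` with `η`.
    refine (h₁.halfLocInt.sub h₂.halfLocInt).ae_eq_zero fun η hη hηc => ?_
    obtain ⟨R, hR⟩ := exists_eq_zero_of_lt hηc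
    have hhη := hh.isDecayTest_corr hη hηc Φ.σ
    have hgη := hg.isDecayTest_corr hη hηc Φ.σ
    obtain ⟨θ₁, s₁, c₁, k₁⟩ := exists_cutoff hhη.1 (corr_eq_zero hR h)
    obtain ⟨θ₂, s₂, c₂, k₂⟩ := exists_cutoff hgη.1 (corr_eq_zero hR g)
    have hk : ∀ t, -1 < t → corr g θ₁ t = corr h θ₂ t := fun t ht => by
      rw [corr_congr_right k₁ g t ht, corr_congr_right k₂ h t ht,
        corr_comm hg hh hη.continuous hηc]
    have e1 := hE θ₁ s₁ c₁
    have e2 : Φ.toFun (corr h θ₂) + _ = _ := hres θ₂ s₂ c₂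
    rw [Φ.toFun_congr (hg.isDecayTest_corr s₁ c₁ _) (hh.isDecayTest_corr s₂ c₂ _) hk,
      setIntegral_congr_fun measurableSet_Ioi (fun t (ht : 0 < t) => hk t (by linarith)), e2,
      setIntegral_congr_fun measurableSet_Ioi (fun t (ht : 0 < t) => k₂ t (by linarith)),
      hcorr η hη hηc] at e1
    exact e1
  rcases ht.eq_or_lt with rfl | ht0
  · rw [h₁.initial, h₂.initial]
  have hsub : ContinuousOn (fun t => q₁ t - q₂ t) (Icc 0 t) :=
    (h₁.continuousOn ht).sub (h₂.continuousOn ht)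
  have hIcc := Measure.eqOn_Icc_of_ae_eq volume ht0.ne (f := fun t => q₁ t - q₂ t) (g := fun _ => 0)
    (by
      have h3 : ∀ᵐ t : ℝ, t ≠ 0 := by simp [ae_iff, measure_singleton]
      refine (ae_restrict_iff' measurableSet_Icc).2 ?_
      filter_upwards [hz, h3] with r hr hr0 hrm
      exact hr (lt_of_le_of_ne hrm.1 (Ne.symm hr0))) hsub continuousOn_const
  exact sub_eq_zero.1 (hIcc ⟨ht, le_rfl⟩)

/-! ### Existence from the resolvent. -/

theorem ae_deriv_eq_of_eq_sub_integral {b : ℂ} {h q : ℝ → ℂ} (hh : HalfLocInt h)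
    (hq : ∀ t, 0 ≤ t → q t = 1 - b * ∫ y in (0 : ℝ)..t, h y) :
    deriv q =ᵐ[volume.restrict (Ioi 0)] fun t => -b * h t := by
  refine (ae_restrict_iff' measurableSet_Ioi).2 ?_
  filter_upwards [LocallyIntegrable.ae_hasDerivAt_integral hh.locallyIntegrable] with t ht (ht0 : 0 < t)
  have h1 := ((ht 0).const_mul b).const_sub 1
  rw [indicator_of_mem (mem_Ioi.2 ht0), ← neg_mul] at h1
  refine (h1.congr_of_eventuallyEq ?_).deriv
  filter_upwards [Ioi_mem_nhds ht0] with r hr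
  rw [hq r (le_of_lt hr)]
  congr 2
  rw [intervalIntegral.integral_of_le (le_of_lt hr), intervalIntegral.integral_of_le (le_of_lt hr)]
  exact setIntegral_congr_fun measurableSet_Ioc fun y hy => (indicator_of_mem (mem_Ioi.2 hy.1) h).symm

/-- Almost everywhere `q' = -(1 - a) h`, so `Φ * q'` is `-(1 - a)` times `Φ * h = H - (1 - a) H *
h`, and the latter is `q` on the half-line. -/
theorem solvesRelaxation_of_resolvent {Φ : CausalDistribution} {a : ℂ} {h : ℝ → ℂ} (hh : HalfLocInt h)
    (hres : ∀ θ : ℝ → ℂ, ContDiff ℝ (⊤ : ℕ∞) θ → HasCompactSupport θ →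
      Φ.convPair h θ + (1 - a) * (∫ t in Ioi (0 : ℝ), corr h θ t) = ∫ t in Ioi (0 : ℝ), θ t)
    {q : ℝ → ℂ} (hq : ∀ t, 0 ≤ t → q t = 1 - (1 - a) * ∫ y in (0 : ℝ)..t, h y) :
    SolvesRelaxation Φ a q where
  initial := by simp [hq 0 le_rfl]
  absCont T hT := by
    have h1 := absolutelyContinuousOnInterval_integral (hh.intervalIntegrable hT)
    have h2 := h1.const_smul (1 - a)
    have h3 : AbsolutelyContinuousOnInterval (fun _ : ℝ => (1 : ℂ)) 0 T := by
      have := absolutelyContinuousOnInterval_integral (g := fun _ => 0) (a := 0) (b := T) (by simp)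
      refine absolutelyContinuousOnInterval_of_dist_le this this fun x _ y _ => ?_
      simp
    refine AbsolutelyContinuousOnInterval.congr (h3.sub h2) fun x hx => ?_
    rw [uIcc_of_le hT] at hx
    rw [hq x hx.1]
    rfl
  equation θ hθ hc := by
    have e1 : corr (deriv q) θ = (-(1 - a)) • corr h θ := by
      rw [corr_congr_left (ae_deriv_eq_of_eq_sub_integral hh hq)]
      funext x
      simp only [corr, Pi.smul_apply, smul_eq_mul, mul_assoc]
      exact integral_const_mul _ _
    have e2 : Φ.toFun (corr h θ) + _ = _ := hres θ hθ hc
    have e3 : ∫ t in Ioi (0 : ℝ), q t * θ t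
        = (∫ t in Ioi (0 : ℝ), θ t) - (1 - a) * ∫ t in Ioi (0 : ℝ), corr h θ t := by
      have hH : HalfLocInt (fun t => ∫ y in (0 : ℝ)..t, h y) := by
        intro M
        rcases le_total 0 M with hM | hM
        · have := (absolutelyContinuousOnInterval_integral (hh.intervalIntegrable hM)).continuousOn
          rw [uIcc_of_le hM] at this
          exact this.integrableOn_Icc.mono_set Ioc_subset_Icc_self
        · simp [Ioc_eq_empty (not_lt.2 hM)]
      rw [setIntegral_corr hh hθ.continuous hc, ← integral_const_mul,
        ← integral_sub (hθ.continuous.integrable_of_hasCompactSupport hc).integrableOn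
          ((hH.integrableOn_mul hθ.continuous hc).const_mul _)]
      refine setIntegral_congr_fun measurableSet_Ioi fun t (ht : 0 < t) => ?_
      rw [hq t ht.le]; ring
    change Φ.toFun (corr (deriv q) θ) = _
    rw [e1, Φ.map_smul _ _ (hh.isDecayTest_corr hθ hc _), e3]
    linear_combination (-(1 - a)) * e2

/-! ### The pointwise equation for kernels given by functions. -/

/-- `e^{-ct} g(t)` on `(0,∞)`, extended by zero. -/
noncomputable def expWeight (c : ℝ) (g : ℝ → ℂ) : ℝ → ℂ :=
  (Ioi 0).indicator fun t => ((Real.exp (-c * t) : ℝ) : ℂ) * g t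

theorem ExpIntegrable.integrable_expWeight {c : ℝ} {g : ℝ → ℂ} (hg : ExpIntegrable c g) :
    Integrable (expWeight c g) := (integrable_indicator_iff measurableSet_Ioi).2 hg

/-- The two weights multiply to `e^{-ct}`, independent of `y`. The causal convolution thus becomes a
convolution of integrable functions on the line, for which existence almost everywhere is standard.
-/
theorem expWeight_mul {c : ℝ} (g φ : ℝ → ℂ) (t y : ℝ) :
    expWeight c g y * expWeight c φ (t - y) =
      ((Real.exp (-c * t) : ℝ) : ℂ) * (Ioo 0 t).indicator (fun y => φ (t - y) * g y) y := by
  by_cases h1 : 0 < y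
  · by_cases h2 : y < t
    · rw [expWeight, expWeight, indicator_of_mem (mem_Ioi.2 h1), indicator_of_mem (mem_Ioi.2 (sub_pos.2 h2)),
        indicator_of_mem (show y ∈ Ioo 0 t from ⟨h1, h2⟩)]
      have : Real.exp (-c * t) = Real.exp (-c * y) * Real.exp (-c * (t - y)) := by
        rw [← Real.exp_add]; ring_nf
      rw [this]; push_cast; ring
    · simp [expWeight, indicator, h1, h2]
  · simp [expWeight, indicator, h1]

theorem integral_expWeight_mul {c : ℝ} (g φ : ℝ → ℂ) {t : ℝ} (ht : 0 < t) :
    ∫ y, expWeight c g y * expWeight c φ (t - y) =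
      ((Real.exp (-c * t) : ℝ) : ℂ) * ∫ y in (0 : ℝ)..t, φ (t - y) * g y := by
  simp only [expWeight_mul]
  rw [integral_const_mul, integral_indicator measurableSet_Ioo, ← integral_Ioc_eq_integral_Ioo,
    intervalIntegral.integral_of_le ht.le]

theorem intervalIntegrable_of_integrable_expWeight {c : ℝ} {g φ : ℝ → ℂ} {t : ℝ} (ht : 0 < t)
    (h : Integrable (fun y => expWeight c g y * expWeight c φ (t - y))) :
    IntervalIntegrable (fun y => φ (t - y) * g y) volume 0 t := by
  simp only [expWeight_mul] at h
  have h1 := h.const_mul (((Real.exp (c * t) : ℝ) : ℂ))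
  rw [intervalIntegrable_iff_integrableOn_Ioo_of_le ht.le, ← integrable_indicator_iff measurableSet_Ioo]
  refine h1.congr (ae_of_all _ fun y => ?_)
  simp only
  rw [← mul_assoc, ← Complex.ofReal_mul, ← Real.exp_add]
  simp

theorem integral_mul_corr_eq {c : ℝ} {φ g Θ : ℝ → ℂ} (hφ : ExpIntegrable c φ) (hg : ExpIntegrable c g)
    (hΘ : Continuous Θ) (hc : HasCompactSupport Θ) :
    ∫ x in Ioi (0 : ℝ), φ x * corr g (fun t => ((Real.exp (-c * t) : ℝ) : ℂ) * Θ t) x =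
      ∫ t, (∫ y, expWeight c g y * expWeight c φ (t - y)) * Θ t := by
  obtain ⟨B, hB⟩ := hΘ.bounded_above_of_compact_support hc
  set a := expWeight c φ
  set b := expWeight c g
  have ha : Integrable a := hφ.integrable_expWeight
  have hb : Integrable b := hg.integrable_expWeight
  have i1 : Integrable (fun p : ℝ × ℝ => b p.2 * a (p.1 - p.2) * Θ p.1) (volume.prod volume) :=
    (hb.convolution_integrand (ContinuousLinearMap.mul ℝ ℂ) ha).mul_bdd
      (hΘ.comp continuous_fst).aestronglyMeasurable (ae_of_all _ fun p => hB p.1)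
  have i2 : Integrable (fun p : ℝ × ℝ => b p.1 * a p.2 * Θ (p.2 + p.1)) (volume.prod volume) :=
    (hb.mul_prod ha).mul_bdd (by fun_prop : Continuous fun p : ℝ × ℝ => Θ (p.2 + p.1)).aestronglyMeasurable
      (ae_of_all _ fun p => hB _)
  calc _ = ∫ x, ∫ y, b y * a x * Θ (x + y) := by
        rw [← integral_indicator measurableSet_Ioi]
        congr 1; funext x
        by_cases hx : x ∈ Ioi (0 : ℝ)
        · rw [indicator_of_mem hx, corr, ← integral_const_mul, ← integral_indicator measurableSet_Ioi]
          congr 1; funext y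
          by_cases hy : y ∈ Ioi (0 : ℝ)
          · simp only [a, b, expWeight, indicator_of_mem hx, indicator_of_mem hy]
            have : Real.exp (-c * (x + y)) = Real.exp (-c * x) * Real.exp (-c * y) := by
              rw [← Real.exp_add]; ring_nf
            rw [this]; push_cast; ring
          · simp only [b, expWeight, indicator_of_notMem hy, zero_mul]
        · simp only [a, expWeight, indicator_of_notMem hx, mul_zero, zero_mul, integral_zero]
    _ = ∫ y, ∫ x, b y * a x * Θ (x + y) := (integral_integral_swap i2).symm
    _ = ∫ y, ∫ t, b y * a (t - y) * Θ t := by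
        congr 1; funext y
        rw [← integral_add_right_eq_self (fun t => b y * a (t - y) * Θ t) y]
        simp only [add_sub_cancel_right]
    _ = ∫ t, ∫ y, b y * a (t - y) * Θ t := (integral_integral_swap i1).symm
    _ = _ := by simp only [integral_mul_const]

/-- When the kernel is a function, the relaxation equation holds pointwise almost everywhere. -/
theorem SolvesRelaxation.ae_integral_eq {Φ : CausalDistribution} {a : ℂ} {q : ℝ → ℂ}
    (hq : SolvesRelaxation Φ a q) {c₀ : ℝ} (hg : ExpIntegrable c₀ (deriv q)) {φ : ℝ → ℂ}
    (hφ : Φ.IsGivenBy φ) :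
    ∀ᵐ t : ℝ, 0 < t → IntervalIntegrable (fun t' => φ (t - t') * deriv q t') volume 0 t ∧
      ∫ t' in (0 : ℝ)..t, φ (t - t') * deriv q t' = -(1 - a) * q t := by
  set c := max c₀ Φ.σ
  have hφ' : ExpIntegrable c φ := ExpIntegrable.mono (le_max_right _ _) hφ.1
  have hg' : ExpIntegrable c (deriv q) := hg.mono (le_max_left _ _)
  set C : ℝ → ℂ := fun t => ∫ y, expWeight c (deriv q) y * expWeight c φ (t - y)
  have hCint : Integrable C :=
    hg'.integrable_expWeight.integrable_convolution (ContinuousLinearMap.mul ℝ ℂ) hφ'.integrable_expWeight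
  set w : ℝ → ℂ := fun t => ((Real.exp (-c * t) : ℝ) : ℂ) * q t
  have hqloc : HalfLocInt w := by
    intro M
    rcases le_total 0 M with h | h
    · exact (((contDiff_ofReal_exp (-c)).continuous.continuousOn.mul
        (hq.continuousOn h)).integrableOn_Icc).mono_set Ioc_subset_Icc_self
    · simp [Ioc_eq_empty (not_lt.2 h)]
  have hz : ∀ᵐ t : ℝ, 0 < t → C t + (1 - a) * w t = 0 := by
    refine HalfLocInt.ae_eq_zero (d := fun t => C t + (1 - a) * w t)
      (fun M => hCint.integrableOn.add ((hqloc M).const_mul (1 - a))) fun η hη hc => ?_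
    -- The factor `e^{-ct}` in the test function is what supplies the weights of `φ` and `q'`.
    set θ : ℝ → ℂ := fun t => ((Real.exp (-c * t) : ℝ) : ℂ) * η t
    have hθ : ContDiff ℝ (⊤ : ℕ∞) θ := (contDiff_ofReal_exp (-c)).mul hη
    have hθc : HasCompactSupport θ := hc.mul_left
    have e1 : Φ.toFun (corr (deriv q) θ) = _ := hq.equation θ hθ hθc
    rw [hφ.2 _ (hq.halfLocInt_deriv.isDecayTest_corr hθ hθc _),
      integral_mul_corr_eq hφ' hg' hη.continuous hc] at e1
    have e2 : ∫ t, C t * η t = ∫ t in Ioi (0 : ℝ), C t * η t := by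
      refine (setIntegral_eq_integral_of_forall_compl_eq_zero fun t ht => ?_).symm
      have : C t = 0 := by
        simp only [C, expWeight_mul, Ioo_eq_empty (mt mem_Ioi.2 ht), indicator_empty, mul_zero, integral_zero]
      rw [this, zero_mul]
    obtain ⟨B, hB⟩ := hη.continuous.bounded_above_of_compact_support hc
    have i1 : IntegrableOn (fun t => C t * η t) (Ioi 0) :=
      (hCint.mul_bdd hη.continuous.aestronglyMeasurable (ae_of_all _ hB)).integrableOn
    have i2 := (hqloc.integrableOn_mul hη.continuous hc).const_mul (1 - a)
    have e3 : ∫ t in Ioi (0 : ℝ), q t * θ t = ∫ t in Ioi (0 : ℝ), w t * η t := by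
      congr 1; funext t; simp only [θ, w]; ring
    simp only [add_mul, mul_assoc]
    rw [integral_add i1 i2, integral_const_mul, ← e2]
    rw [e3] at e1
    linear_combination e1
  filter_upwards [hz, hg'.integrable_expWeight.ae_convolution_exists (ContinuousLinearMap.mul ℝ ℂ)
    hφ'.integrable_expWeight] with t ht hex h0
  refine ⟨intervalIntegrable_of_integrable_expWeight h0 hex, ?_⟩
  have h1 := ht h0
  simp only [C, w, integral_expWeight_mul (deriv q) φ h0] at h1
  have h2 : ((Real.exp (-c * t) : ℝ) : ℂ) ≠ 0 := by exact_mod_cast (Real.exp_pos _).ne'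
  refine mul_left_cancel₀ h2 ?_
  linear_combination h1

/-! ### The transform of a randomly indexed statistic. -/

theorem distFun_add (μ ν : Measure ℝ) [IsFiniteMeasure μ] [IsFiniteMeasure ν] :
    distFun (μ + ν) = distFun μ + distFun ν := by
  funext u
  simp [distFun, measureReal_add_apply]

theorem distFun_smul (c : ℝ≥0∞) (μ : Measure ℝ) : distFun (c • μ) = c.toReal • distFun μ := by
  funext u
  simp [distFun, measureReal_def]

theorem rvCdf_eq_distFun {Ω : Type*} [MeasurableSpace Ω] (P : Measure Ω) {Y : Ω → ℝ} (hY : Measurable Y) :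
    rvCdf P Y = distFun (P.map Y) := by
  funext u
  simp only [rvCdf, distFun, measureReal_def]
  rw [Measure.map_apply hY measurableSet_Iic]
  rfl

theorem IsTransform.distFun_zero {W : Type*} {L : (ℝ → ℝ) → W → ℂ} {ρ : W → ℝ → ℝ≥0∞}
    (hL : IsTransform L ρ) (w : W) : L (distFun 0) w = 0 := by
  have := hL.bound w 0 inferInstance
  simpa using this

section Mixture

variable {Ω W : Type*} [MeasurableSpace Ω] {P : Measure Ω}
  {L : (ℝ → ℝ) → W → ℂ} {ρ : W → ℝ → ℝ≥0∞} {N : Ω → ℕ} {Z : ℕ → Ω → ℝ} {S : Ω → ℝ}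

theorem map_restrict_eq_smul_of_indepFun (hN : Measurable N) (hS : Measurable S)
    (hSZ : ∀ ω, S ω = Z (N ω) ω) (hZ : ∀ n, Measurable (Z n))
    (hind : ∀ n, IndepFun (Z n) N P) (n : ℕ) :
    (P.restrict (N ⁻¹' {n})).map S = P (N ⁻¹' {n}) • P.map (Z n) := by
  have hn : MeasurableSet (N ⁻¹' {n}) := hN (measurableSet_singleton n)
  ext B hB
  rw [Measure.map_apply hS hB, Measure.restrict_apply (hS hB), Measure.smul_apply,
    Measure.map_apply (hZ n) hB, smul_eq_mul, mul_comm,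
    ← (hind n).measure_inter_preimage_eq_mul B {n} hB (measurableSet_singleton n)]
  congr 1
  ext ω
  simp only [mem_inter_iff, mem_preimage, mem_singleton_iff]
  refine and_congr_left fun h => ?_
  rw [hSZ, h]

theorem lintegral_map_restrict_lt_top (hL : IsTransform L ρ) (w : W) (hS : Measurable S)
    (hfin : ∫⁻ ω, ρ w (S ω) ∂P < ∞) (A : Set Ω) : ∫⁻ u, ρ w u ∂(P.restrict A).map S < ∞ := by
  rw [lintegral_map (hL.measurable w) hS]
  exact (setLIntegral_le_lintegral _ _).trans_lt hfin

variable [IsProbabilityMeasure P]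

theorem IsTransform.map_restrict_eq (hL : IsTransform L ρ) (w : W) (hN : Measurable N) (hS : Measurable S)
    (hSZ : ∀ ω, S ω = Z (N ω) ω) (hZ : ∀ n, Measurable (Z n)) (hind : ∀ n, IndepFun (Z n) N P)
    (hfin : ∫⁻ ω, ρ w (S ω) ∂P < ∞) (n : ℕ) :
    L (distFun ((P.restrict (N ⁻¹' {n})).map S)) w = (P.real (N ⁻¹' {n}) : ℂ) * L (rvCdf P (Z n)) w := by
  have hlt := lintegral_map_restrict_lt_top hL w hS hfin (N ⁻¹' {n})
  rw [map_restrict_eq_smul_of_indepFun hN hS hSZ hZ hind n] at hlt ⊢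
  -- Finiteness of the weight under the law of `Z n` is inherited from `S` only when `{N = n}` has
  -- positive probability. Otherwise both sides are zero.
  by_cases h0 : P (N ⁻¹' {n}) = 0
  · rw [measureReal_def, h0, zero_smul, hL.distFun_zero]; simp
  · rw [lintegral_smul_measure, smul_eq_mul] at hlt
    have h1 : ∫⁻ u, ρ w u ∂P.map (Z n) < ∞ := by
      by_contra h
      rw [not_lt, top_le_iff] at h
      rw [h, ENNReal.mul_top h0] at hlt
      exact lt_irrefl _ hlt
    have : IsProbabilityMeasure (P.map (Z n)) := Measure.isProbabilityMeasure_map (hZ n).aemeasurable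
    rw [distFun_smul, hL.map_smul w _ _ ENNReal.toReal_nonneg inferInstance h1, rvCdf_eq_distFun P (hZ n)]
    rfl

theorem IsTransform.map_restrict_lt (hL : IsTransform L ρ) (w : W) (hN : Measurable N) (hS : Measurable S)
    (hSZ : ∀ ω, S ω = Z (N ω) ω) (hZ : ∀ n, Measurable (Z n)) (hind : ∀ n, IndepFun (Z n) N P)
    (hfin : ∫⁻ ω, ρ w (S ω) ∂P < ∞) (k : ℕ) :
    L (distFun ((P.restrict (N ⁻¹' Iio k)).map S)) w =
      ∑ n ∈ Finset.range k, (P.real (N ⁻¹' {n}) : ℂ) * L (rvCdf P (Z n)) w := by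
  induction k with
  | zero => simp [hL.distFun_zero]
  | succ k ih =>
    have hd : Disjoint (N ⁻¹' Iio k) (N ⁻¹' {k}) := Disjoint.preimage _ (by simp)
    have hu : N ⁻¹' Iio (k + 1) = N ⁻¹' Iio k ∪ N ⁻¹' {k} := by
      ext ω; simp; omega
    rw [hu, Measure.restrict_union hd (hN (measurableSet_singleton k)), Measure.map_add _ _ hS,
      distFun_add, hL.map_add w _ _ inferInstance inferInstance
        (lintegral_map_restrict_lt_top hL w hS hfin _) (lintegral_map_restrict_lt_top hL w hS hfin _),
      ih, hL.map_restrict_eq w hN hS hSZ hZ hind hfin, Finset.sum_range_succ]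

/-- The transform of the law of a random element of an independent sequence is the mixture of the
transforms. -/
theorem IsTransform.tendsto_mixture (hL : IsTransform L ρ) (w : W) (hN : Measurable N) (hS : Measurable S)
    (hSZ : ∀ ω, S ω = Z (N ω) ω) (hZ : ∀ n, Measurable (Z n)) (hind : ∀ n, IndepFun (Z n) N P)
    (hfin : ∫⁻ ω, ρ w (S ω) ∂P < ∞) :
    Tendsto (fun k => ∑ n ∈ Finset.range k, (P.real (N ⁻¹' {n}) : ℂ) * L (rvCdf P (Z n)) w) atTop
      (𝓝 (L (rvCdf P S) w)) := by
  -- `L` is only finitely additive; the domination by `ρ` bounds the remainder on `{N ≥ k}` by this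
  -- tail and so yields the infinite mixture.
  have htail : Tendsto (fun k => ∫⁻ ω in N ⁻¹' Ici k, ρ w (S ω) ∂P) atTop (𝓝 0) := by
    refine tendsto_setLIntegral_zero hfin.ne ?_
    have := tendsto_measure_iInter_atTop (μ := P) (s := fun k : ℕ => N ⁻¹' Ici k)
      (fun k => (hN measurableSet_Ici).nullMeasurableSet)
      (fun i j hij => preimage_mono (Ici_subset_Ici.2 hij)) ⟨0, measure_ne_top _ _⟩
    have he : ⋂ k : ℕ, N ⁻¹' Ici k = ∅ := by
      ext ω
      simp only [mem_iInter, mem_preimage, mem_Ici, mem_empty_iff_false, iff_false, not_forall, not_le]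
      exact ⟨N ω + 1, by omega⟩
    rw [he, measure_empty] at this
    exact this
  have hsplit : ∀ k, L (rvCdf P S) w =
      (∑ n ∈ Finset.range k, (P.real (N ⁻¹' {n}) : ℂ) * L (rvCdf P (Z n)) w) +
        L (distFun ((P.restrict (N ⁻¹' Ici k)).map S)) w := by
    intro k
    have hPk : P.map S = (P.restrict (N ⁻¹' Iio k)).map S + (P.restrict (N ⁻¹' Ici k)).map S := by
      rw [← Measure.map_add _ _ hS]
      have := Measure.restrict_add_restrict_compl (μ := P) (hN (measurableSet_Iio (a := k)))
      rw [← preimage_compl, compl_Iio] at this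
      rw [this]
    rw [rvCdf_eq_distFun P hS, hPk, distFun_add, hL.map_add w _ _ inferInstance inferInstance
        (lintegral_map_restrict_lt_top hL w hS hfin _) (lintegral_map_restrict_lt_top hL w hS hfin _),
      hL.map_restrict_lt w hN hS hSZ hZ hind hfin]
  have h0 : Tendsto (fun k => L (distFun ((P.restrict (N ⁻¹' Ici k)).map S)) w) atTop (𝓝 0) := by
    rw [tendsto_zero_iff_enorm_tendsto_zero]
    refine tendsto_of_tendsto_of_tendsto_of_le_of_le tendsto_const_nhds htail (fun _ => zero_le) fun k => ?_
    refine (hL.bound w _ inferInstance).trans ?_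
    rw [lintegral_map (hL.measurable w) hS]
  have h1 := (tendsto_const_nhds (x := L (rvCdf P S) w) (f := atTop (α := ℕ))).sub h0
  rw [sub_zero] at h1
  refine h1.congr fun k => ?_
  rw [hsplit k]; ring

end Mixture

/-! ### Measurability and independence of the counting process. -/

section Renewal

variable {Ω : Type*} [MeasurableSpace Ω]

theorem measurable_epoch {J : ℕ → Ω → ℝ} (hJ : ∀ i, Measurable (J i)) (n : ℕ) : Measurable (epoch J n) := by
  unfold epoch
  exact Finset.measurable_sum _ fun i _ => hJ i

/-- The second alternative records the default value `0` of the supremum on empty and unbounded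
sets. It makes `{N(t) = n}` a countable combination of events with no exceptional null set. -/
theorem Nat.sSup_eq_iff (s : Set ℕ) (n : ℕ) :
    sSup s = n ↔ (n ∈ s ∧ ∀ m ∈ s, m ≤ n) ∨ (n = 0 ∧ ((∀ m, m ∉ s) ∨ ∀ k, ∃ m ∈ s, k < m)) := by
  by_cases hb : BddAbove s
  · rcases s.eq_empty_or_nonempty with rfl | hne
    · simp [eq_comm]
    · have hmem : sSup s ∈ s := Nat.sSup_mem hne hb
      constructor
      · rintro rfl
        exact Or.inl ⟨hmem, fun m hm => le_csSup hb hm⟩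
      · rintro (⟨h1, h2⟩ | ⟨-, h | h⟩)
        · exact le_antisymm (h2 _ hmem) (le_csSup hb h1)
        · exact absurd hmem (h _)
        · obtain ⟨B, hB⟩ := hb
          obtain ⟨m, hm, hlt⟩ := h B
          exact absurd (hB hm) (not_le.2 hlt)
  · rw [Nat.sSup_of_not_bddAbove hb]
    constructor
    · rintro rfl
      refine Or.inr ⟨rfl, Or.inr fun k => ?_⟩
      by_contra! h
      exact hb ⟨k, h⟩
    · rintro (⟨h1, h2⟩ | ⟨h, -⟩)
      · exact absurd ⟨n, h2⟩ hb
      · exact h.symm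

theorem measurable_count {J : ℕ → Ω → ℝ} (hJ : ∀ i, Measurable (J i)) (t : ℝ) : Measurable (count J t) := by
  refine measurable_to_countable' fun n => ?_
  have : count J t ⁻¹' {n} = {ω | (epoch J n ω ≤ t ∧ ∀ m, epoch J m ω ≤ t → m ≤ n) ∨
      (n = 0 ∧ ((∀ m, ¬ epoch J m ω ≤ t) ∨ ∀ k, ∃ m, epoch J m ω ≤ t ∧ k < m))} := by
    ext ω
    exact Nat.sSup_eq_iff _ n
  rw [this]
  have hm : ∀ m, Measurable fun ω => epoch J m ω ≤ t := fun m =>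
    measurableSet_setOfPred.1 (measurableSet_le (measurable_epoch hJ m) measurable_const)
  refine measurableSet_setOfPred.2 (Measurable.or ?_ ?_)
  · exact (hm n).and (Measurable.forall fun m => (hm m).imp measurable_const)
  · exact measurable_const.and (Measurable.or (Measurable.forall fun m => (hm m).not)
      (Measurable.forall fun k => Measurable.exists fun m => (hm m).and measurable_const))

theorem measurable_stat {X : ℕ → Ω → ℝ} (hX : ∀ i, Measurable (X i)) {G : (n : ℕ) → (Fin n → ℝ) → ℝ}
    (hG : ∀ n, Measurable (G n)) (n : ℕ) : Measurable (stat G X n) :=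
  (hG n).comp (measurable_pi_lambda _ fun i => hX i)

theorem measurable_ctStat {X J : ℕ → Ω → ℝ} (hX : ∀ i, Measurable (X i)) (hJ : ∀ i, Measurable (J i))
    {G : (n : ℕ) → (Fin n → ℝ) → ℝ} (hG : ∀ n, Measurable (G n)) (t : ℝ) : Measurable (ctStat G X J t) := by
  have h : Measurable (fun p : ℕ × Ω => stat G X p.1 p.2) :=
    measurable_from_prod_countable_right fun n => measurable_stat hX hG n
  exact h.comp ((measurable_count hJ t).prodMk measurable_id)

/-- Each variable is a measurable function of one of the two sequences, as seen by applying the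
measurability lemmas to the coordinate process on `ℕ → ℝ`. -/
theorem indepFun_stat_count {P : Measure Ω} {X J : ℕ → Ω → ℝ}
    (hXJ : IndepFun (fun ω i => X i ω) (fun ω i => J i ω) P) {G : (n : ℕ) → (Fin n → ℝ) → ℝ}
    (hG : ∀ n, Measurable (G n)) (t : ℝ) (n : ℕ) : IndepFun (stat G X n) (count J t) P :=
  hXJ.comp (φ := fun x : ℕ → ℝ => stat G (fun i (y : ℕ → ℝ) => y i) n x)
    (ψ := fun j : ℕ → ℝ => count (fun i (y : ℕ → ℝ) => y i) t j)
    (measurable_stat (fun i => measurable_pi_apply i) hG n) (measurable_count (fun i => measurable_pi_apply i) t)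

end Renewal

/-! ### Epochs, their densities and the renewal series. -/

theorem integrable_tsum_of_summable_integral_norm {α : Type*} [MeasurableSpace α] {μ : Measure α}
    {F : ℕ → α → ℂ} (hF : ∀ n, Integrable (F n) μ) (hm : ∀ n, Measurable (F n))
    (hs : Summable fun n => ∫ x, ‖F n x‖ ∂μ) : Integrable (fun x => ∑' n, F n x) μ := by
  refine ⟨(Measurable.tsum hm).aestronglyMeasurable, ?_⟩
  calc ∫⁻ x, ‖∑' n, F n x‖ₑ ∂μ ≤ ∫⁻ x, ∑' n, ‖F n x‖ₑ ∂μ :=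
        lintegral_mono fun x => enorm_tsum_le_tsum_enorm
    _ = ∑' n, ∫⁻ x, ‖F n x‖ₑ ∂μ := lintegral_tsum fun n => (hm n).enorm.aemeasurable
    _ = ∑' n, ENNReal.ofReal (∫ x, ‖F n x‖ ∂μ) := by
        congr 1; funext n
        exact (ofReal_integral_norm_eq_lintegral_enorm (hF n)).symm
    _ < ∞ := by
        rw [← ENNReal.ofReal_tsum_of_nonneg (fun n => integral_nonneg fun _ => norm_nonneg _) hs]
        exact ENNReal.ofReal_lt_top

section Renewal

variable {Ω : Type*} {J : ℕ → Ω → ℝ}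

theorem strictMono_epoch {ω : Ω} (h : ∀ i, 0 < J i ω) : StrictMono fun n => epoch J n ω :=
  strictMono_nat_of_lt_succ fun n => by
    simp only [epoch, Finset.sum_range_succ]
    linarith [h n]

theorem epoch_zero (ω : Ω) : epoch J 0 ω = 0 := by simp [epoch]

theorem epoch_nonneg {ω : Ω} (h : ∀ i, 0 < J i ω) (n : ℕ) : 0 ≤ epoch J n ω := by
  rw [← epoch_zero (J := J) ω]; exact (strictMono_epoch h).monotone n.zero_le

theorem epoch_succ_pos {ω : Ω} (h : ∀ i, 0 < J i ω) (n : ℕ) : 0 < epoch J (n + 1) ω := by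
  rw [← epoch_zero (J := J) ω]; exact strictMono_epoch h n.succ_pos

theorem count_eq_iff {ω : Ω} (h : ∀ i, 0 < J i ω) {t : ℝ} (ht : 0 ≤ t) (hex : ∃ n, t < epoch J n ω) (n : ℕ) :
    count J t ω = n ↔ epoch J n ω ≤ t ∧ ¬ epoch J (n + 1) ω ≤ t := by
  have hmono := (strictMono_epoch h)
  rw [count, Nat.sSup_eq_iff]
  constructor
  · rintro (⟨h1, h2⟩ | ⟨-, h1 | h1⟩)
    · exact ⟨h1, fun h3 => absurd (h2 _ h3) (by omega)⟩
    · exact absurd (show epoch J 0 ω ≤ t by rwa [epoch_zero]) (h1 0)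
    · obtain ⟨m, hm⟩ := hex
      obtain ⟨k, hk, hmk⟩ := h1 m
      have := hmono hmk
      simp only [mem_ofPred_eq] at hk
      linarith
  · rintro ⟨h1, h2⟩
    refine Or.inl ⟨h1, fun m (hm : epoch J m ω ≤ t) => ?_⟩
    by_contra! hlt
    exact h2 ((hmono.monotone (Nat.succ_le_of_lt hlt)).trans hm)

variable [MeasurableSpace Ω] {P : Measure Ω}

theorem mgf_epoch (hJm : ∀ i, Measurable (J i)) (hJind : iIndepFun J P)
    (hJid : ∀ i, IdentDistrib (J i) (J 0) P P) (s : ℝ) (n : ℕ) :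
    mgf (epoch J n) P s = mgf (J 0) P s ^ n := by
  have h := hJind.mgf_sum hJm (t := s) (Finset.range n)
  have e : epoch J n = ∑ i ∈ Finset.range n, J i := by
    funext ω; simp [epoch]
  rw [e, h, Finset.prod_congr rfl fun i _ => congrFun (mgf_congr_identDistrib (hJid i)) s]
  simp

theorem ae_forall_pos (hJpos : ∀ i, ∀ᵐ ω ∂P, 0 < J i ω) : ∀ᵐ ω ∂P, ∀ i, 0 < J i ω := ae_all_iff.2 hJpos

/-- The density of the epoch `T_{n+1}`. -/
noncomputable def epochDensity (P : Measure Ω) (J : ℕ → Ω → ℝ) (n : ℕ) (x : ℝ) : ℝ :=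
  ((P.map (epoch J (n + 1))).rnDeriv volume x).toReal

theorem measurable_epochDensity (n : ℕ) : Measurable (epochDensity P J n) :=
  (Measure.measurable_rnDeriv _ _).ennreal_toReal

theorem epochDensity_nonneg (n : ℕ) (x : ℝ) : 0 ≤ epochDensity P J n x := ENNReal.toReal_nonneg

theorem laplaceFun_eq_mgf (hJm : Measurable (J 0)) (hJpos : ∀ᵐ ω ∂P, 0 < J 0 ω) {f : ℝ → ℝ} (hfm : Measurable f)
    (hf0 : ∀ t, 0 ≤ f t) (hf : P.map (J 0) = volume.withDensity (fun t => ENNReal.ofReal (f t))) (s : ℝ) :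
    laplaceFun f s = mgf (J 0) P (-s) := by
  have h1 := setIntegral_withDensity_eq_setIntegral_toReal_smul (μ := volume) (s := Ioi (0 : ℝ))
    hfm.ennreal_ofReal (ae_of_all _ fun _ => ENNReal.ofReal_lt_top) (fun x => Real.exp (-s * x)) measurableSet_Ioi
  rw [← hf, ← integral_indicator measurableSet_Ioi, integral_map hJm.aemeasurable
    (Measurable.indicator (by fun_prop) measurableSet_Ioi).aestronglyMeasurable] at h1
  rw [laplaceFun, mgf]
  refine Eq.trans (integral_congr_ae (ae_of_all _ fun x => ?_)) (h1.symm.trans (integral_congr_ae ?_))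
  · simp only [ENNReal.toReal_ofReal (hf0 x), smul_eq_mul, mul_comm]
  · filter_upwards [hJpos] with ω hω
    rw [indicator_of_mem (mem_Ioi.2 hω)]

/-- The resolvent function `∑ a^n f^{*(n+1)}` of the renewal process. -/
noncomputable def renewalSeries (P : Measure Ω) (J : ℕ → Ω → ℝ) (a : ℂ) (x : ℝ) : ℂ :=
  ∑' n, a ^ n * (epochDensity P J n x : ℂ)

theorem norm_exp_term (s x : ℝ) (a : ℂ) (n : ℕ) :
    ‖((Real.exp (-s * x) : ℝ) : ℂ) * (a ^ n * (epochDensity P J n x : ℂ))‖ =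
      ‖a‖ ^ n * (Real.exp (-s * x) * epochDensity P J n x) := by
  rw [norm_mul, norm_mul, norm_pow, Complex.norm_real, Complex.norm_real, Real.norm_eq_abs, Real.norm_eq_abs,
    abs_of_pos (Real.exp_pos _), abs_of_nonneg (epochDensity_nonneg n x)]
  ring

variable [IsProbabilityMeasure P]

theorem integrable_exp_neg_mul {Y : Ω → ℝ} (hY : Measurable Y) (hpos : ∀ᵐ ω ∂P, 0 ≤ Y ω) {s : ℝ} (hs : 0 ≤ s) :
    Integrable (fun ω => Real.exp (-s * Y ω)) P := by
  refine Integrable.mono' (integrable_const (1 : ℝ)) (by fun_prop) ?_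
  filter_upwards [hpos] with ω h
  rw [Real.norm_eq_abs, abs_of_pos (Real.exp_pos _)]
  exact Real.exp_le_one_iff.2 (by nlinarith)

/-- Dominated convergence, by strict positivity. This limit is what allows `a` of any modulus. -/
theorem tendsto_mgf_neg_atTop {Y : Ω → ℝ} (hY : Measurable Y) (hpos : ∀ᵐ ω ∂P, 0 < Y ω) :
    Tendsto (fun s : ℝ => mgf Y P (-s)) atTop (𝓝 0) := by
  have := tendsto_integral_filter_of_dominated_convergence (μ := P) (l := atTop)
    (F := fun (s : ℝ) ω => Real.exp (-s * Y ω)) (f := fun _ => 0) (fun _ => 1)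
    (Eventually.of_forall fun s => by fun_prop)
    (by
      filter_upwards [eventually_ge_atTop 0] with s hs
      filter_upwards [hpos] with ω h
      rw [Real.norm_eq_abs, abs_of_pos (Real.exp_pos _)]
      exact Real.exp_le_one_iff.2 (by nlinarith))
    (integrable_const 1)
    (by
      filter_upwards [hpos] with ω h
      refine Real.tendsto_exp_atBot.comp ?_
      simp only [neg_mul]
      exact tendsto_neg_atTop_atBot.comp (tendsto_id.atTop_mul_const h))
  simpa [mgf] using this

/-- The Chernoff bound for the epochs. -/
theorem measureReal_epoch_le (hJm : ∀ i, Measurable (J i)) (hJind : iIndepFun J P)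
    (hJid : ∀ i, IdentDistrib (J i) (J 0) P P) (hJpos : ∀ i, ∀ᵐ ω ∂P, 0 < J i ω) {s : ℝ} (hs : 0 ≤ s)
    (t : ℝ) (n : ℕ) : P.real {ω | epoch J n ω ≤ t} ≤ Real.exp (s * t) * mgf (J 0) P (-s) ^ n := by
  have := measure_le_le_exp_mul_mgf (μ := P) (X := epoch J n) (t := -s) t (by linarith)
    (integrable_exp_neg_mul (measurable_epoch hJm n)
      ((ae_forall_pos hJpos).mono fun ω h => epoch_nonneg h n) hs)
  rwa [mgf_epoch hJm hJind hJid, neg_neg] at this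

/-- For `s` with `E e^{-sJ} < 1` the Chernoff bound for `T_n ≤ t` decays geometrically. Hence `N(t)`
is almost surely finite and never takes the default value of an unbounded supremum. -/
theorem ae_exists_lt_epoch (hJm : ∀ i, Measurable (J i)) (hJind : iIndepFun J P)
    (hJid : ∀ i, IdentDistrib (J i) (J 0) P P) (hJpos : ∀ i, ∀ᵐ ω ∂P, 0 < J i ω) (t : ℝ) :
    ∀ᵐ ω ∂P, ∃ n, t < epoch J n ω := by
  obtain ⟨s, hs1, hs0⟩ := (((tendsto_mgf_neg_atTop (hJm 0) (hJpos 0)).eventually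
    (gt_mem_nhds (show (0 : ℝ) < 1 by norm_num))).and (eventually_ge_atTop 0)).exists
  have hlim : Tendsto (fun n => Real.exp (s * t) * mgf (J 0) P (-s) ^ n) atTop (𝓝 0) := by
    simpa using (tendsto_pow_atTop_nhds_zero_of_lt_one mgf_nonneg hs1).const_mul (Real.exp (s * t))
  have hle : ∀ n, P.real {ω | ∀ n, epoch J n ω ≤ t} ≤ Real.exp (s * t) * mgf (J 0) P (-s) ^ n := fun n =>
    (measureReal_mono fun ω (h : ∀ n, epoch J n ω ≤ t) => h n).trans (measureReal_epoch_le hJm hJind hJid hJpos hs0 t n)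
  have h0 : P.real {ω | ∀ n, epoch J n ω ≤ t} = 0 :=
    le_antisymm (ge_of_tendsto' hlim hle) measureReal_nonneg
  rw [measureReal_eq_zero_iff] at h0
  rw [ae_iff]
  simpa using h0

theorem measureReal_count_eq (hJm : ∀ i, Measurable (J i)) (hJind : iIndepFun J P)
    (hJid : ∀ i, IdentDistrib (J i) (J 0) P P) (hJpos : ∀ i, ∀ᵐ ω ∂P, 0 < J i ω) {t : ℝ} (ht : 0 ≤ t) (n : ℕ) :
    P.real (count J t ⁻¹' {n}) = P.real {ω | epoch J n ω ≤ t} - P.real {ω | epoch J (n + 1) ω ≤ t} := by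
  have hm : ∀ m, MeasurableSet {ω | epoch J m ω ≤ t} := fun m =>
    measurableSet_le (measurable_epoch hJm m) measurable_const
  have h1 : P.real (count J t ⁻¹' {n}) = P.real ({ω | epoch J n ω ≤ t} \ {ω | epoch J (n + 1) ω ≤ t}) := by
    refine measureReal_congr ?_
    filter_upwards [ae_forall_pos hJpos, ae_exists_lt_epoch hJm hJind hJid hJpos t] with ω hω hex
    exact propext (count_eq_iff hω ht hex n)
  have h2 : P.real ({ω | epoch J n ω ≤ t} ∩ {ω | epoch J (n + 1) ω ≤ t}) = P.real {ω | epoch J (n + 1) ω ≤ t} := by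
    refine measureReal_congr ?_
    filter_upwards [ae_forall_pos hJpos] with ω hω
    refine propext ⟨fun h => h.2, fun (h : epoch J (n + 1) ω ≤ t) => ⟨?_, h⟩⟩
    exact ((strictMono_epoch hω).monotone n.le_succ).trans h
  rw [h1, ← h2, ← measureReal_inter_add_sdiff (μ := P) (s := {ω | epoch J n ω ≤ t}) (hm (n + 1))]
  ring

/-- Convolution with the law of the last duration is enough. The index is `n + 1` because `T_0 = 0`
has no density. -/
theorem map_epoch_succ_absolutelyContinuous (hJm : ∀ i, Measurable (J i)) (hJind : iIndepFun J P)
    (hJid : ∀ i, IdentDistrib (J i) (J 0) P P) (hac : P.map (J 0) ≪ volume) (n : ℕ) :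
    P.map (epoch J (n + 1)) ≪ volume := by
  have e : epoch J (n + 1) = epoch J n + J n := by
    funext ω; simp [epoch, Finset.sum_range_succ]
  have hind : IndepFun (epoch J n) (J n) P := by
    have := hJind.indepFun_sum_range_succ hJm n
    rwa [show ∑ i ∈ Finset.range n, J i = epoch J n by funext ω; simp [epoch]] at this
  rw [e, hind.map_add_eq_map_conv_map (measurable_epoch hJm n) (hJm n), (hJid n).map_eq]
  exact Measure.conv_absolutelyContinuous hac

theorem integrable_epochDensity (n : ℕ) : Integrable (epochDensity P J n) :=
  Measure.integrable_toReal_rnDeriv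

theorem setIntegral_epochDensity (hJm : ∀ i, Measurable (J i)) (hJind : iIndepFun J P)
    (hJid : ∀ i, IdentDistrib (J i) (J 0) P P) (hJpos : ∀ i, ∀ᵐ ω ∂P, 0 < J i ω)
    (hac : P.map (J 0) ≪ volume) (n : ℕ) (t : ℝ) :
    ∫ x in Ioc 0 t, epochDensity P J n x = P.real {ω | epoch J (n + 1) ω ≤ t} := by
  have : IsProbabilityMeasure (P.map (epoch J (n + 1))) :=
    Measure.isProbabilityMeasure_map (measurable_epoch hJm _).aemeasurable
  unfold epochDensity
  rw [Measure.setIntegral_toReal_rnDeriv (map_epoch_succ_absolutelyContinuous hJm hJind hJid hac n),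
    measureReal_def, Measure.map_apply (measurable_epoch hJm _) measurableSet_Ioc, ← measureReal_def]
  refine measureReal_congr ?_
  filter_upwards [ae_forall_pos hJpos] with ω hω
  exact propext ⟨fun h => h.2, fun h => ⟨epoch_succ_pos hω n, h⟩⟩

theorem setIntegral_exp_mul_epochDensity (hJm : ∀ i, Measurable (J i)) (hJind : iIndepFun J P)
    (hJid : ∀ i, IdentDistrib (J i) (J 0) P P) (hJpos : ∀ i, ∀ᵐ ω ∂P, 0 < J i ω)
    (hac : P.map (J 0) ≪ volume) (n : ℕ) (s : ℝ) :
    ∫ x in Ioi (0 : ℝ), Real.exp (-s * x) * epochDensity P J n x = mgf (J 0) P (-s) ^ (n + 1) := by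
  have : IsProbabilityMeasure (P.map (epoch J (n + 1))) :=
    Measure.isProbabilityMeasure_map (measurable_epoch hJm _).aemeasurable
  have h1 := integral_rnDeriv_smul (f := (Ioi (0 : ℝ)).indicator fun x => Real.exp (-s * x))
    (map_epoch_succ_absolutelyContinuous hJm hJind hJid hac n)
  have hm : Measurable ((Ioi (0 : ℝ)).indicator fun x => Real.exp (-s * x)) :=
    Measurable.indicator (by fun_prop) measurableSet_Ioi
  rw [integral_map (measurable_epoch hJm _).aemeasurable hm.aestronglyMeasurable] at h1
  rw [← mgf_epoch hJm hJind hJid, mgf, ← integral_indicator measurableSet_Ioi]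
  refine Eq.trans (integral_congr_ae (ae_of_all _ fun x => ?_)) (h1.trans (integral_congr_ae ?_))
  · by_cases hx : x ∈ Ioi (0 : ℝ)
    · simp only [indicator_of_mem hx, smul_eq_mul, epochDensity, mul_comm]
    · simp only [indicator_of_notMem hx, smul_zero]
  · filter_upwards [ae_forall_pos hJpos] with ω hω
    rw [indicator_of_mem (mem_Ioi.2 (epoch_succ_pos hω n))]

theorem integrable_exp_term {s : ℝ} (hs : 0 ≤ s) (a : ℂ) (n : ℕ) :
    IntegrableOn (fun x => ((Real.exp (-s * x) : ℝ) : ℂ) * (a ^ n * (epochDensity P J n x : ℂ))) (Ioi 0) := by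
  have h1 : Integrable (fun x => a ^ n * (epochDensity P J n x : ℂ)) :=
    (integrable_epochDensity n).ofReal.const_mul _
  refine h1.integrableOn.bdd_mul (c := 1) (contDiff_ofReal_exp (-s)).continuous.aestronglyMeasurable ?_
  refine (ae_restrict_iff' measurableSet_Ioi).2 (ae_of_all _ fun x (hx : 0 < x) => ?_)
  rw [Complex.norm_real, Real.norm_eq_abs, abs_of_pos (Real.exp_pos _)]
  exact Real.exp_le_one_iff.2 (by nlinarith)

variable (hJm : ∀ i, Measurable (J i)) (hJind : iIndepFun J P)
  (hJid : ∀ i, IdentDistrib (J i) (J 0) P P) (hJpos : ∀ i, ∀ᵐ ω ∂P, 0 < J i ω)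
  (hac : P.map (J 0) ≪ volume)

include hJm hJind hJid hJpos hac

theorem summable_integral_norm_exp_term {s : ℝ} {a : ℂ} (ha : ‖a‖ * mgf (J 0) P (-s) < 1) :
    Summable fun n => ∫ x in Ioi (0 : ℝ), ‖((Real.exp (-s * x) : ℝ) : ℂ) * (a ^ n * (epochDensity P J n x : ℂ))‖ := by
  simp only [norm_exp_term, integral_const_mul, setIntegral_exp_mul_epochDensity hJm hJind hJid hJpos hac]
  have := (summable_geometric_of_lt_one (mul_nonneg (norm_nonneg a) mgf_nonneg) ha).mul_left (mgf (J 0) P (-s))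
  refine this.congr fun n => ?_
  rw [mul_pow]; ring

/-- The weighted `L¹` norms of the terms form a geometric series of ratio `‖a‖ * mgf (J 0) P (-s)`.
-/
theorem expIntegrable_renewalSeries {s : ℝ} (hs : 0 ≤ s) {a : ℂ} (ha : ‖a‖ * mgf (J 0) P (-s) < 1) :
    ExpIntegrable s (renewalSeries P J a) := by
  have := integrable_tsum_of_summable_integral_norm (fun n => integrable_exp_term hs a n)
    (fun n => (contDiff_ofReal_exp (-s)).continuous.measurable.mul
      ((Complex.measurable_ofReal.comp (measurable_epochDensity n)).const_mul _))
    (summable_integral_norm_exp_term hJm hJind hJid hJpos hac ha)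
  simp only [tsum_mul_left] at this
  exact this

theorem integral_renewalSeries_mul_exp {s : ℝ} (hs : 0 ≤ s) {a : ℂ} (ha : ‖a‖ * mgf (J 0) P (-s) < 1) :
    ∫ x in Ioi (0 : ℝ), renewalSeries P J a x * Complex.exp (-(s : ℂ) * x) =
      mgf (J 0) P (-s) / (1 - a * mgf (J 0) P (-s)) := by
  have h1 := hasSum_integral_of_summable_integral_norm (fun n => integrable_exp_term hs a n)
    (summable_integral_norm_exp_term hJm hJind hJid hJpos hac ha)
  have e1 : ∀ n, ∫ x in Ioi (0 : ℝ), ((Real.exp (-s * x) : ℝ) : ℂ) * (a ^ n * (epochDensity P J n x : ℂ)) =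
      (mgf (J 0) P (-s) : ℂ) * (a * (mgf (J 0) P (-s) : ℂ)) ^ n := by
    intro n
    have : ∀ x, ((Real.exp (-s * x) : ℝ) : ℂ) * (a ^ n * (epochDensity P J n x : ℂ)) =
        a ^ n * ((Real.exp (-s * x) * epochDensity P J n x : ℝ) : ℂ) := by
      intro x; push_cast; ring
    simp only [this]
    rw [integral_const_mul, integral_complex_ofReal,
      setIntegral_exp_mul_epochDensity hJm hJind hJid hJpos hac]
    push_cast
    rw [mul_pow]; ring
  simp only [e1, tsum_mul_left] at h1
  have hn : ‖a * (mgf (J 0) P (-s) : ℂ)‖ < 1 := by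
    rwa [norm_mul, Complex.norm_real, Real.norm_eq_abs, abs_of_nonneg mgf_nonneg]
  have h2 := (hasSum_geometric_of_norm_lt_one hn).mul_left (mgf (J 0) P (-s) : ℂ)
  have h3 := h1.unique h2
  rw [div_eq_mul_inv, ← h3]
  congr 1; funext x
  rw [mul_comm]
  simp [renewalSeries]

theorem hasSum_integral_renewalSeries {s : ℝ} (hs : 0 ≤ s) {a : ℂ} (ha : ‖a‖ * mgf (J 0) P (-s) < 1) {t : ℝ} (ht : 0 ≤ t) :
    HasSum (fun n => a ^ n * (P.real {ω | epoch J (n + 1) ω ≤ t} : ℂ)) (∫ x in (0 : ℝ)..t, renewalSeries P J a x) := by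
  have hint : ∀ n, IntegrableOn (fun x => a ^ n * (epochDensity P J n x : ℂ)) (Ioc 0 t) := fun n =>
    ((integrable_epochDensity n).ofReal.const_mul _).integrableOn
  have hs' : Summable fun n => ∫ x in Ioc 0 t, ‖a ^ n * (epochDensity P J n x : ℂ)‖ := by
    have e : ∀ n x, ‖a ^ n * (epochDensity P J n x : ℂ)‖ = ‖a‖ ^ n * epochDensity P J n x := fun n x => by
      rw [norm_mul, norm_pow, Complex.norm_real, Real.norm_eq_abs, abs_of_nonneg (epochDensity_nonneg n x)]
    simp only [e, integral_const_mul, setIntegral_epochDensity hJm hJind hJid hJpos hac]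
    refine Summable.of_nonneg_of_le (fun n => by positivity) (fun n => ?_)
      ((summable_geometric_of_lt_one (mul_nonneg (norm_nonneg a) mgf_nonneg) ha).mul_left
        (Real.exp (s * t) * mgf (J 0) P (-s)))
    calc _ ≤ ‖a‖ ^ n * (Real.exp (s * t) * mgf (J 0) P (-s) ^ (n + 1)) := by
          gcongr; exact measureReal_epoch_le hJm hJind hJid hJpos hs t (n + 1)
      _ = _ := by rw [mul_pow]; ring
  have h1 := hasSum_integral_of_summable_integral_norm hint hs'
  rw [intervalIntegral.integral_of_le ht]
  refine (congrArg (HasSum · _) (funext fun n => ?_)).mp h1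
  rw [integral_const_mul, integral_complex_ofReal, setIntegral_epochDensity hJm hJind hJid hJpos hac]

/-- Summation by parts: with `I = ∫_0^t h`, one has `∑ a^n F_{n+1} = I` and, since `F_0 = 1`, `∑ a^n
F_n = 1 + a I`. The difference is the limit. -/
theorem tendsto_sum_measureReal_count {s : ℝ} (hs : 0 ≤ s) {a : ℂ} (ha : ‖a‖ * mgf (J 0) P (-s) < 1) {t : ℝ} (ht : 0 ≤ t) :
    Tendsto (fun k => ∑ n ∈ Finset.range k, (P.real (count J t ⁻¹' {n}) : ℂ) * a ^ n) atTop
      (𝓝 (1 - (1 - a) * ∫ x in (0 : ℝ)..t, renewalSeries P J a x)) := by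
  have h1 := hasSum_integral_renewalSeries hJm hJind hJid hJpos hac hs ha ht
  have h2 : HasSum (fun n => a ^ n * (P.real {ω | epoch J n ω ≤ t} : ℂ))
      (1 + a * ∫ x in (0 : ℝ)..t, renewalSeries P J a x) := by
    rw [← hasSum_nat_add_iff' 1]
    simp only [Finset.range_one, Finset.sum_singleton, pow_zero, epoch_zero, one_mul]
    have e0 : P.real {ω : Ω | (0 : ℝ) ≤ t} = 1 := by simp [ht]
    rw [e0]
    push_cast
    rw [add_sub_cancel_left]
    refine (congrArg (HasSum · _) (funext fun n => ?_)).mp (h1.mul_left a)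
    rw [pow_succ]; ring
  have h3 := (h2.sub h1).tendsto_sum_nat
  have e : (1 + a * ∫ x in (0 : ℝ)..t, renewalSeries P J a x) - ∫ x in (0 : ℝ)..t, renewalSeries P J a x =
      1 - (1 - a) * ∫ x in (0 : ℝ)..t, renewalSeries P J a x := by ring
  rw [e] at h3
  refine h3.congr fun k => Finset.sum_congr rfl fun n _ => ?_
  rw [measureReal_count_eq hJm hJind hJid hJpos ht]
  push_cast
  ring

end Renewal

end CTStat

/-! ### The Cauchy problem for the continuous-time statistic. -/

theorem mainTheorem3
    {Ω : Type*} [MeasurableSpace Ω] (P : Measure Ω) [IsProbabilityMeasure P]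
    -- the observations and the inter-event durations
    (X J : ℕ → Ω → ℝ)
    (hXm : ∀ i, Measurable (X i)) (hJm : ∀ i, Measurable (J i))
    (hXind : iIndepFun X P) (hXid : ∀ i, IdentDistrib (X i) (X 0) P P)
    (hJind : iIndepFun J P) (hJid : ∀ i, IdentDistrib (J i) (J 0) P P)
    (hXJ : IndepFun (fun ω i => X i ω) (fun ω i => J i ω) P)
    (hJpos : ∀ i, ∀ᵐ ω ∂P, 0 < J i ω)
    -- the density of the durations
    (f : ℝ → ℝ) (hfm : Measurable f) (hf0 : ∀ t, 0 ≤ f t)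
    (hf : P.map (J 0) = volume.withDensity (fun t => ENNReal.ofReal (f t)))
    -- the statistics, and the transform under which they are of convolution type
    (G : (n : ℕ) → (Fin n → ℝ) → ℝ) (hG : ∀ n, Measurable (G n))
    {W : Type*} (L : (ℝ → ℝ) → W → ℂ) (ρ : W → ℝ → ℝ≥0∞) (hL : CTStat.IsTransform L ρ)
    (w : W)
    (hconv : ∀ n, L (CTStat.rvCdf P (CTStat.stat G X n)) w
      = (L (CTStat.rvCdf P (X 0)) w) ^ n)
    (hdom : ∀ t : ℝ, 0 ≤ t → ∫⁻ ω, ρ w (CTStat.ctStat G X J t ω) ∂P < ∞)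
    -- the memory kernel
    (Φ : CTStat.CausalDistribution)
    (hΦ : ∀ᶠ s : ℝ in atTop,
      Φ.laplace s = ((1 - CTStat.laplaceFun f s) / (s * CTStat.laplaceFun f s) : ℝ)) :
    CTStat.SolvesRelaxation Φ (L (CTStat.rvCdf P (X 0)) w)
        (fun t => L (CTStat.rvCdf P (CTStat.ctStat G X J t)) w) ∧
      (∀ q : ℝ → ℂ, CTStat.SolvesRelaxation Φ (L (CTStat.rvCdf P (X 0)) w) q →
        ∀ t : ℝ, 0 ≤ t → q t = L (CTStat.rvCdf P (CTStat.ctStat G X J t)) w) ∧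
      ∀ φ : ℝ → ℂ, Φ.IsGivenBy φ → ∀ᵐ t : ℝ, 0 < t →
        IntervalIntegrable (fun t' => φ (t - t') *
          deriv (fun r => L (CTStat.rvCdf P (CTStat.ctStat G X J r)) w) t') volume 0 t ∧
        ∫ t' in (0 : ℝ)..t, φ (t - t') *
            deriv (fun r => L (CTStat.rvCdf P (CTStat.ctStat G X J r)) w) t'
          = -(1 - L (CTStat.rvCdf P (X 0)) w) * L (CTStat.rvCdf P (CTStat.ctStat G X J t)) w := by

  set a := L (CTStat.rvCdf P (X 0)) w
  set q : ℝ → ℂ := fun t => L (CTStat.rvCdf P (CTStat.ctStat G X J t)) w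
  have hac : P.map (J 0) ≪ volume := hf ▸ withDensity_absolutelyContinuous _ _
  have hlim : Tendsto (fun s : ℝ => ‖a‖ * mgf (J 0) P (-s)) atTop (𝓝 0) := by
    simpa using (CTStat.tendsto_mgf_neg_atTop (hJm 0) (hJpos 0)).const_mul ‖a‖
  have hev : ∀ᶠ s : ℝ in atTop, 0 < s ∧ ‖a‖ * mgf (J 0) P (-s) < 1 :=
    (eventually_gt_atTop 0).and (hlim.eventually (gt_mem_nhds one_pos))
  obtain ⟨s₁, hs₁, ha₁⟩ := hev.exists
  set h := CTStat.renewalSeries P J a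
  have hh : CTStat.ExpIntegrable s₁ h :=
    CTStat.expIntegrable_renewalSeries hJm hJind hJid hJpos hac hs₁.le ha₁
  have hq : ∀ t, 0 ≤ t → q t = 1 - (1 - a) * ∫ y in (0 : ℝ)..t, h y := by
    intro t ht
    have h1 := hL.tendsto_mixture w (CTStat.measurable_count hJm t) (CTStat.measurable_ctStat hXm hJm hG t)
      (fun _ => rfl) (fun n => CTStat.measurable_stat hXm hG n) (CTStat.indepFun_stat_count hXJ hG t)
      (hdom t ht)
    simp only [hconv] at h1
    exact tendsto_nhds_unique h1
      (CTStat.tendsto_sum_measureReal_count hJm hJind hJid hJpos hac hs₁.le ha₁ ht)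
  -- With `m = E e^{-sJ}`, the first factor is `(1 - a m)/(s m)` and the second is `m/(1 - a m)`;
  -- `|a| m < 1` keeps the denominator nonzero.
  have hLap : ∀ᶠ s : ℝ in atTop, (Φ.laplace s + (1 - a) / s) *
      (∫ y in Ioi (0 : ℝ), h y * Complex.exp (-(s : ℂ) * y)) = 1 / s := by
    filter_upwards [hΦ, hev] with s hs hs'
    have hpos : 0 < mgf (J 0) P (-s) := mgf_pos (CTStat.integrable_exp_neg_mul (hJm 0)
      ((hJpos 0).mono fun _ h => h.le) hs'.1.le)
    have n1 : (mgf (J 0) P (-s) : ℂ) ≠ 0 := by exact_mod_cast hpos.ne'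
    have n2 : (s : ℂ) ≠ 0 := by exact_mod_cast hs'.1.ne'
    have n3 : 1 - a * (mgf (J 0) P (-s) : ℂ) ≠ 0 := by
      intro h0
      have : ‖a * (mgf (J 0) P (-s) : ℂ)‖ = 1 := by rw [← sub_eq_zero.1 h0, norm_one]
      rw [norm_mul, Complex.norm_real, Real.norm_eq_abs, abs_of_pos hpos] at this
      exact hs'.2.ne this
    rw [CTStat.integral_renewalSeries_mul_exp hJm hJind hJid hJpos hac hs'.1.le hs'.2, hs,
      CTStat.laplaceFun_eq_mgf (hJm 0) (hJpos 0) hfm hf0 hf]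
    push_cast
    rw [mul_comm a] at n3 ⊢
    field_simp
    ring
  have hres := fun θ hθ hc => CTStat.convPair_resolvent (θ := θ) Φ a hh hLap hθ hc
  have hsol : CTStat.SolvesRelaxation Φ a q := CTStat.solvesRelaxation_of_resolvent hh.halfLocInt hres hq
  refine ⟨hsol, fun q' hq' t ht => CTStat.SolvesRelaxation.unique hh.halfLocInt hres hq' hsol t ht,
    fun φ hφ => hsol.ae_integral_eq (c₀ := s₁) ?_ hφ⟩
  refine (hh.const_mul (-(1 - a))).congr ?_
  filter_upwards [CTStat.ae_deriv_eq_of_eq_sub_integral hh.halfLocInt hq] with t ht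
  rw [ht]; ring
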